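/- Let $\Sigma$ be a closed surface, i.e. a compact Hausdorff two-dimensional manifold without boundary, of class $C^2$ (not necessarily connected or orientable), let $n\in\mathbb N$, and let $f:\Sigma\to\mathbb R^n\setminus\{0\}$ be an immersion of class $C^2$. Let $I:\mathbb R^n\setminus\{0\}\to\mathbb R^n\setminus\{0\}$, $I(x)=x/\|x\|^2$, be the inversion. For a $C^2$ immersion $h:\Sigma\to\mathbb R^n$, written in local coordinates, let $g_{ij}=\langle\partial_i h,\partial_j h\rangle$ be the induced metric with inverse $(g^{ij})$, let $\mu_h$ be the induced area measure on $\Sigma$, given by $d\mu_h=\sqrt{\det(g_{ij})}\,du^1du^2$ in every chart, let $A_{ij}=(\partial_i\partial_j h)^{\perp}$ be the second fundamental form, where $\perp$ denotes the orthogonal projection onto the normal space of $h$, let $H_h=\sum_{i,j}g^{ij}A_{ij}$ be the mean curvature vector, and let $$W(h)=\frac14\int_\Sigma |H_h|^2\,d\mu_h$$ be the Willmore energy. Then $I\circ f$ is again a $C^2$ immersion, the functions $|H_f|^2$ and $|H_{I\circ f}|^2$ are integrable with respect to $\mu_f$ and $\mu_{I\circ f}$ respectively, and $$W(f)=\frac14\int_\Sigma|H_f|^2\,d\mu_f=\frac14\int_\Sigma|H_{I\circ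 f}|^2\,d\mu_{I\circ f}=W(I\circ f).$$ -/

import Mathlib

open MeasureTheory
open scoped Manifold ContDiff

noncomputable section

namespace Willmore

/-- The parameter plane `ℝ²`. -/
abbrev Plane : Type := EuclideanSpace ℝ (Fin 2)

/-- The ambient space `ℝⁿ` with its Euclidean norm. -/
abbrev Ambient (n : ℕ) : Type := EuclideanSpace ℝ (Fin n)

/-! ### Local parametrisations `F : ℝ² → ℝⁿ` -/

/-- The partial derivative `∂ᵢ F (u)`. -/
def partialDeriv {n : ℕ} (F : Plane → Ambient n) (i : Fin 2) (u : Plane) : Ambient n :=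
  fderiv ℝ F u (EuclideanSpace.single i 1)

/-- The first fundamental form `gᵢⱼ = ⟨∂ᵢ F, ∂ⱼ F⟩` at `u`. -/
def metricMatrix {n : ℕ} (F : Plane → Ambient n) (u : Plane) : Matrix (Fin 2) (Fin 2) ℝ :=
  Matrix.of fun i j => inner ℝ (partialDeriv F i u) (partialDeriv F j u)

/-- The area element `√(det g)` at `u`. -/
def areaDensity {n : ℕ} (F : Plane → Ambient n) (u : Plane) : ℝ :=
  Real.sqrt (metricMatrix F u).det

/-- The tangent plane of `F` at `u`, as a subspace of `ℝⁿ`. -/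
def tangentPlane {n : ℕ} (F : Plane → Ambient n) (u : Plane) : Submodule ℝ (Ambient n) :=
  Submodule.span ℝ (Set.range fun i : Fin 2 => partialDeriv F i u)

/-- The second fundamental form `Aᵢⱼ = (∂ᵢ ∂ⱼ F)^⊥ = ∂ᵢ ∂ⱼ F - P^T (∂ᵢ ∂ⱼ F)` at `u`, where `P^T` is
the orthogonal projection onto the tangent plane. -/
def secondFundamentalForm {n : ℕ} (F : Plane → Ambient n) (i j : Fin 2) (u : Plane) : Ambient n :=
  partialDeriv (partialDeriv F j) i u -
    (tangentPlane F u).starProjection (partialDeriv (partialDeriv F j) i u)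

/-- The mean curvature vector `gⁱʲ Aᵢⱼ` of a local parametrisation, where `gⁱʲ` are the entries of
the inverse matrix of `gᵢⱼ`. -/
def localMeanCurvature {n : ℕ} (F : Plane → Ambient n) (u : Plane) : Ambient n :=
  ∑ i : Fin 2, ∑ j : Fin 2, (metricMatrix F u)⁻¹ i j • secondFundamentalForm F i j u

/-! ### Immersed surfaces `f : Σ → ℝⁿ` -/

section Surface

variable {n : ℕ} {S : Type*} [TopologicalSpace S] [ChartedSpace Plane S]

/-- `f` is a `C²` immersion: it is of class `C²` and its differential is injective everywhere. -/
structure IsC2Immersion (f : S → Ambient n) : Prop where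
  contMDiff : ContMDiff (𝓡 2) 𝓘(ℝ, Ambient n) 2 f
  injective_mfderiv : ∀ p : S, Function.Injective (mfderiv (𝓡 2) 𝓘(ℝ, Ambient n) f p)

/-- The mean curvature vector `H_f` at `p`, computed in the preferred chart at `p`. For a `C²`
immersion every chart around `p` gives the same vector. -/
def meanCurvature (f : S → Ambient n) (p : S) : Ambient n :=
  localMeanCurvature (f ∘ (chartAt Plane p).symm) (chartAt Plane p p)

/-- The area measure of the part of the surface covered by the chart `e`: the measure
`√(det g) du` on the open set `e.target ⊆ ℝ²`, transported to `e.source` by `e⁻¹`. -/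
def chartAreaMeasure [MeasurableSpace S] (f : S → Ambient n)
    (e : OpenPartialHomeomorph S Plane) : Measure S :=
  Measure.map e.symm ((volume.restrict e.target).withDensity
    fun u => ENNReal.ofReal (areaDensity (f ∘ e.symm) u))

/-- The area measure `μ_f` induced by `f`. On the overlap of two charts their area measures agree,
and the area measure is the measure glued from them, i.e. the least measure on the surface that
dominates the area measure of every chart of the atlas. -/
def areaMeasure [MeasurableSpace S] (f : S → Ambient n) : Measure S :=
  ⨆ e ∈ atlas Plane S, chartAreaMeasure f e

/-- The Willmore energy `W(f) = ¼ ∫ |H_f|² dμ_f`. -/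
def energy [MeasurableSpace S] (f : S → Ambient n) : ℝ :=
  (1 / 4) * ∫ p, ‖meanCurvature f p‖ ^ 2 ∂(areaMeasure f)

end Surface

/-- The inversion `I(x) = x / |x|²` at the unit sphere (used for `x ≠ 0` only). -/
def inversion {n : ℕ} (x : Ambient n) : Ambient n :=
  (‖x‖ ^ 2)⁻¹ • x

end Willmore

end

/-! The Willmore integrand changes under inversion by an exact divergence, and a divergence
integrates to zero over a closed surface.

The differential of `I` at `x` is `|x|⁻²` times the reflection along `x`
(`fderiv_inversion_eq_reflectAlong`). Hence the metric of `I ∘ f` is `|f|⁻⁴ g`, its area element is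
`|f|⁻⁴` times the old one, and its mean curvature vector is the reflection of `|f|² H + 4 f^⊥`
(`localMeanCurvature_inversion_comp`). Taking norms, `|H_{I∘f}|² dμ_{I∘f} = (|H|² + 8 (⟨H, f⟩ / |f|²
+ 2 |f^⊥|² / |f|⁴)) dμ_f`. The factor of `8` is the Laplacian of `log |f|`, that is, the divergence
of `V = f^T / |f|²` (`divergence_logField`).

Since `V` involves only first derivatives of `f`, it is `C¹` in charts and may be integrated by
parts. For a `C²` function `ρ` supported in one chart, the two integrals weighted by `ρ` differ by
`-8 ∫ ⟨dρ, V⟩` (`integral_mul_inversion_comp`). For a finite partition of unity the differentials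
`dρ_k` sum to zero, so these corrections cancel. Orientation plays no role, because only the density
`√(det g) du` is used.

The rest is chart independence: of `H` and `⟨dρ, V⟩` by the transformation law of traces
(`sum_gramMatrix_inv_comp`), and of the area measure by the change of variables formula
(`restrict_areaMeasure`). -/

noncomputable section

namespace Willmore

/-! ### Linear algebra of the first fundamental form -/

/-- The standard basis vector of the parameter plane. -/
abbrev stdVec (i : Fin 2) : Plane := EuclideanSpace.single i 1

/-- The Gram matrix of a linear map on the parameter plane. -/
def gramMatrix {n : ℕ} (L : Plane →L[ℝ] Ambient n) : Matrix (Fin 2) (Fin 2) ℝ :=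
  Matrix.of fun i j => inner ℝ (L (stdVec i)) (L (stdVec j))

theorem metricMatrix_eq_gramMatrix {n : ℕ} (F : Plane → Ambient n) (u : Plane) :
    metricMatrix F u = gramMatrix (fderiv ℝ F u) := rfl

theorem plane_eq_sum (v : Plane) : v = ∑ k, v k • stdVec k := by
  ext i
  fin_cases i <;> simp [Fin.sum_univ_two]

theorem linearIndependent_stdVec_image {n : ℕ} {L : Plane →L[ℝ] Ambient n}
    (hL : Function.Injective L) : LinearIndependent ℝ fun i => L (stdVec i) := by
  have h := (EuclideanSpace.basisFun (Fin 2) ℝ).toBasis.linearIndependent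
  have := h.map' (L : Plane →ₗ[ℝ] Ambient n) (LinearMap.ker_eq_bot.2 hL)
  have e : (fun i => L (stdVec i)) =
      (L : Plane →ₗ[ℝ] Ambient n) ∘ (EuclideanSpace.basisFun (Fin 2) ℝ).toBasis := by
    ext i
    simp
  rw [e]
  exact this

theorem gramMatrix_posDef {n : ℕ} {L : Plane →L[ℝ] Ambient n}
    (hL : Function.Injective L) : (gramMatrix L).PosDef :=
  Matrix.posDef_gram_of_linearIndependent (linearIndependent_stdVec_image hL)

theorem gramMatrix_det_pos {n : ℕ} {L : Plane →L[ℝ] Ambient n}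
    (hL : Function.Injective L) : 0 < (gramMatrix L).det :=
  (gramMatrix_posDef hL).det_pos

/-- The matrix of a linear endomorphism of the parameter plane. -/
def jacobianMatrix (J : Plane →L[ℝ] Plane) : Matrix (Fin 2) (Fin 2) ℝ :=
  Matrix.of fun k i => J (stdVec i) k

theorem jacobianMatrix_det (J : Plane →L[ℝ] Plane) : (jacobianMatrix J).det = J.det := by
  have : jacobianMatrix J = LinearMap.toMatrix (EuclideanSpace.basisFun (Fin 2) ℝ).toBasis
      (EuclideanSpace.basisFun (Fin 2) ℝ).toBasis (J : Plane →ₗ[ℝ] Plane) := by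
    ext k i
    simp [jacobianMatrix, LinearMap.toMatrix_apply]
  rw [this, LinearMap.det_toMatrix]

theorem gramMatrix_comp {n : ℕ} (L : Plane →L[ℝ] Ambient n) (J : Plane →L[ℝ] Plane) :
    gramMatrix (L.comp J) = (jacobianMatrix J).transpose * gramMatrix L * jacobianMatrix J := by
  have h (i : Fin 2) : L (J (stdVec i)) =
      J (stdVec i) 0 • L (stdVec 0) + J (stdVec i) 1 • L (stdVec 1) := by
    conv_lhs => rw [plane_eq_sum (J (stdVec i))]
    simp [Fin.sum_univ_two]
  ext i j
  simp only [gramMatrix, Matrix.of_apply, ContinuousLinearMap.comp_apply, h,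
    Matrix.mul_apply, Fin.sum_univ_two, Matrix.transpose_apply, jacobianMatrix, inner_add_left,
    inner_add_right, inner_smul_left, inner_smul_right]
  simp only [conj_trivial]
  ring

theorem gramMatrix_comp_det {n : ℕ} (L : Plane →L[ℝ] Ambient n) (J : Plane →L[ℝ] Plane) :
    (gramMatrix (L.comp J)).det = J.det ^ 2 * (gramMatrix L).det := by
  rw [gramMatrix_comp, Matrix.det_mul, Matrix.det_mul, Matrix.det_transpose, jacobianMatrix_det]
  ring

/-- The trace of a bilinear map with respect to the metric does not depend on the coordinates. -/
theorem sum_gramMatrix_inv_comp {n : ℕ} {E : Type*} [NormedAddCommGroup E] [NormedSpace ℝ E]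
    (L : Plane →L[ℝ] Ambient n) (J : Plane →L[ℝ] Plane) (hJ : J.det ≠ 0)
    (β : Plane →L[ℝ] Plane →L[ℝ] E) :
    ∑ i, ∑ j, (gramMatrix (L.comp J))⁻¹ i j • β (J (stdVec i)) (J (stdVec j)) =
      ∑ i, ∑ j, (gramMatrix L)⁻¹ i j • β (stdVec i) (stdVec j) := by
  have hu : IsUnit (jacobianMatrix J).det := by
    rw [jacobianMatrix_det]; exact isUnit_iff_ne_zero.2 hJ
  have hut : IsUnit (jacobianMatrix J).transpose.det := by rwa [Matrix.det_transpose]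
  -- The Gram matrix becomes `Jᵀ g J`, whose inverse is `J⁻¹ g⁻¹ J⁻ᵀ`; the outer factors cancel
  -- against those produced by bilinearity of `β`.
  have key : jacobianMatrix J * (gramMatrix (L.comp J))⁻¹ * (jacobianMatrix J).transpose =
      (gramMatrix L)⁻¹ := by
    rw [gramMatrix_comp, Matrix.mul_inv_rev, Matrix.mul_inv_rev]
    simp only [← mul_assoc]
    rw [Matrix.mul_nonsing_inv _ hu, one_mul, mul_assoc, Matrix.nonsing_inv_mul _ hut, mul_one]
  have h (i j : Fin 2) : β (J (stdVec i)) (J (stdVec j)) =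
      ∑ k, ∑ l, (J (stdVec i) k * J (stdVec j) l) • β (stdVec k) (stdVec l) := by
    conv_lhs => rw [plane_eq_sum (J (stdVec i)), plane_eq_sum (J (stdVec j))]
    simp [Fin.sum_univ_two, smul_smul]
  rw [← key]
  simp only [h, Fin.sum_univ_two, Matrix.mul_apply, Matrix.transpose_apply, jacobianMatrix,
    Matrix.of_apply]
  module

/-- No invertibility is required: for `det g = 0` both the matrix inverse and the quotients are zero
by convention. -/
theorem inv_fin_two_apply (g : Matrix (Fin 2) (Fin 2) ℝ) :
    g⁻¹ 0 0 = g 1 1 / g.det ∧ g⁻¹ 0 1 = -g 0 1 / g.det ∧ g⁻¹ 1 0 = -g 1 0 / g.det ∧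
      g⁻¹ 1 1 = g 0 0 / g.det := by
  rw [Matrix.inv_def, Matrix.adjugate_fin_two]
  simp [div_eq_inv_mul]

/-! ### Characterisation of the mean curvature vector -/

section Local

variable {n : ℕ} {F : Plane → Ambient n} {u : Plane}

theorem tangentPlane_eq_range (F : Plane → Ambient n) (u : Plane) :
    tangentPlane F u = LinearMap.range (fderiv ℝ F u : Plane →ₗ[ℝ] Ambient n) := by
  apply le_antisymm
  · rw [tangentPlane, Submodule.span_le]
    rintro _ ⟨i, rfl⟩
    exact ⟨_, rfl⟩
  · rintro _ ⟨v, rfl⟩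
    rw [plane_eq_sum v]
    simp only [map_sum, map_smul]
    exact Submodule.sum_mem _ fun i _ => Submodule.smul_mem _ _ (Submodule.subset_span ⟨i, rfl⟩)

theorem partialDeriv_mem_tangentPlane (F : Plane → Ambient n) (i : Fin 2) (u : Plane) :
    partialDeriv F i u ∈ tangentPlane F u := Submodule.subset_span ⟨i, rfl⟩

theorem inner_eq_zero_of_mem_tangentPlane {h w : Ambient n}
    (hh : ∀ i, inner ℝ h (partialDeriv F i u) = 0) (hw : w ∈ tangentPlane F u) :
    inner ℝ h w = 0 := by
  induction hw using Submodule.span_induction with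
  | mem x hx => obtain ⟨i, rfl⟩ := hx; exact hh i
  | zero => simp
  | add x y _ _ hx hy => rw [inner_add_right, hx, hy, add_zero]
  | smul a x _ hx => rw [inner_smul_right, hx, mul_zero]

/-- The metric trace of the second derivatives of a local parametrisation. -/
def hessianTrace (F : Plane → Ambient n) (u : Plane) : Ambient n :=
  ∑ i : Fin 2, ∑ j : Fin 2, (metricMatrix F u)⁻¹ i j • partialDeriv (partialDeriv F j) i u

theorem localMeanCurvature_eq (F : Plane → Ambient n) (u : Plane) :
    localMeanCurvature F u =
      hessianTrace F u - (tangentPlane F u).starProjection (hessianTrace F u) := by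
  simp only [localMeanCurvature, hessianTrace, secondFundamentalForm, map_sum, map_smul, smul_sub,
    Finset.sum_sub_distrib]

/-- Uniqueness of the splitting into tangential and normal parts. Both transformation laws of the
mean curvature, under reparametrisation and under inversion, are obtained from this criterion
without computing a projection. -/
theorem localMeanCurvature_eq_of {h : Ambient n}
    (hh : ∀ i, inner ℝ h (partialDeriv F i u) = 0)
    (hM : hessianTrace F u - h ∈ tangentPlane F u) : localMeanCurvature F u = h := by
  rw [localMeanCurvature_eq, Submodule.eq_starProjection_of_mem_of_inner_eq_zero hM]
  · abel
  · intro w hw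
    rw [sub_sub_cancel]
    exact inner_eq_zero_of_mem_tangentPlane hh hw

theorem inner_localMeanCurvature_partialDeriv (F : Plane → Ambient n) (u : Plane) (i : Fin 2) :
    inner ℝ (localMeanCurvature F u) (partialDeriv F i u) = 0 := by
  rw [localMeanCurvature_eq]
  exact Submodule.starProjection_inner_eq_zero _ _ (partialDeriv_mem_tangentPlane F i u)

theorem hessianTrace_sub_localMeanCurvature_mem (F : Plane → Ambient n) (u : Plane) :
    hessianTrace F u - localMeanCurvature F u ∈ tangentPlane F u := by
  rw [localMeanCurvature_eq, sub_sub_cancel]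
  exact Submodule.starProjection_apply_mem _ _

/-- The tangential part of a vector, in terms of the first fundamental form. -/
def tangentialPart (F : Plane → Ambient n) (u : Plane) (w : Ambient n) : Ambient n :=
  ∑ i, ∑ j, ((metricMatrix F u)⁻¹ i j * inner ℝ w (partialDeriv F i u)) • partialDeriv F j u

theorem metricMatrix_det_pos (hF : Function.Injective (fderiv ℝ F u)) :
    0 < (metricMatrix F u).det := gramMatrix_det_pos hF

theorem metricMatrix_symm (F : Plane → Ambient n) (u : Plane) (i j : Fin 2) :
    metricMatrix F u i j = metricMatrix F u j i := by
  simp only [metricMatrix, Matrix.of_apply]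
  exact real_inner_comm _ _

theorem tangentialPart_mem (F : Plane → Ambient n) (u : Plane) (w : Ambient n) :
    tangentialPart F u w ∈ tangentPlane F u :=
  Submodule.sum_mem _ fun _ _ => Submodule.sum_mem _ fun j _ =>
    Submodule.smul_mem _ _ (partialDeriv_mem_tangentPlane F j u)

theorem inner_tangentialPart_partialDeriv (hF : Function.Injective (fderiv ℝ F u)) (w : Ambient n)
    (k : Fin 2) :
    inner ℝ (tangentialPart F u w) (partialDeriv F k u) = inner ℝ w (partialDeriv F k u) := by
  have hD := (metricMatrix_det_pos hF).ne'
  obtain ⟨h00, h01, h10, h11⟩ := inv_fin_two_apply (metricMatrix F u)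
  have e : (metricMatrix F u).det = _ := Matrix.det_fin_two _
  have hg (i j : Fin 2) : inner ℝ (partialDeriv F i u) (partialDeriv F j u) =
    metricMatrix F u i j := rfl
  have hs := metricMatrix_symm F u 1 0
  simp only [tangentialPart, Fin.sum_univ_two, inner_add_left, inner_smul_left, h00, h01, h10, h11,
    hg, conj_trivial, hs]
  rw [hs] at e
  fin_cases k <;> simp only [Fin.zero_eta, Fin.mk_one, hs] <;> field_simp <;> rw [e] <;> ring

/-- The explicit formula makes the dependence of the projection on `u` visible, which is needed for
continuity and for computing the divergence. -/
theorem starProjection_tangentPlane (hF : Function.Injective (fderiv ℝ F u)) (w : Ambient n) :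
    (tangentPlane F u).starProjection w = tangentialPart F u w := by
  refine Submodule.eq_starProjection_of_mem_of_inner_eq_zero (tangentialPart_mem F u w) ?_
  intro v hv
  refine inner_eq_zero_of_mem_tangentPlane (F := F) (u := u) (fun i => ?_) hv
  rw [inner_sub_left, inner_tangentialPart_partialDeriv hF, sub_self]

end Local

/-! ### Change of parameters -/

section Reparametrisation

variable {n : ℕ} {F G : Plane → Ambient n} {φ : Plane → Plane} {u : Plane}

theorem partialDeriv_congr (h : F =ᶠ[nhds u] G) (i : Fin 2) :
    partialDeriv F i =ᶠ[nhds u] partialDeriv G i := by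
  filter_upwards [h.fderiv (𝕜 := ℝ)] with v hv
  rw [partialDeriv, hv, partialDeriv]

theorem metricMatrix_congr (h : F =ᶠ[nhds u] G) : metricMatrix F u = metricMatrix G u := by
  simp only [metricMatrix, (partialDeriv_congr h _).eq_of_nhds]

theorem localMeanCurvature_congr (h : F =ᶠ[nhds u] G) :
    localMeanCurvature F u = localMeanCurvature G u := by
  have h1 (i : Fin 2) := (partialDeriv_congr h i).eq_of_nhds
  have h2 (i j : Fin 2) := (partialDeriv_congr (partialDeriv_congr h j) i).eq_of_nhds
  simp only [localMeanCurvature, secondFundamentalForm, metricMatrix, tangentPlane, h1, h2]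

theorem _root_.ContDiffAt.differentiableAt_fderiv {E E' : Type*} [NormedAddCommGroup E]
    [NormedSpace ℝ E] [NormedAddCommGroup E'] [NormedSpace ℝ E'] {F : E → E'} {u : E}
    (hF : ContDiffAt ℝ 2 F u) :
    DifferentiableAt ℝ (fderiv ℝ F) u :=
  (hF.fderiv_right (m := 1) (by norm_num)).differentiableAt (by norm_num)

theorem partialDeriv_partialDeriv (hF : ContDiffAt ℝ 2 F u) (i j : Fin 2) :
    partialDeriv (partialDeriv F j) i u = fderiv ℝ (fderiv ℝ F) u (stdVec i) (stdVec j) := by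
  have h := hF.differentiableAt_fderiv.hasFDerivAt.clm_apply (hasFDerivAt_const (stdVec j) u)
  have e : fderiv ℝ (partialDeriv F j) u = _ := h.fderiv
  rw [partialDeriv, e]
  simp

theorem partialDeriv_partialDeriv_comm (hF : ContDiffAt ℝ 2 F u) (i j : Fin 2) :
    partialDeriv (partialDeriv F j) i u = partialDeriv (partialDeriv F i) j u := by
  rw [partialDeriv_partialDeriv hF, partialDeriv_partialDeriv hF]
  exact (hF.isSymmSndFDerivAt (by simp)) _ _

theorem fderiv_comp_eventuallyEq (hF : ContDiffAt ℝ 2 F (φ u)) (hφ : ContDiffAt ℝ 2 φ u) :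
    fderiv ℝ (F ∘ φ) =ᶠ[nhds u] fun v => (fderiv ℝ F (φ v)).comp (fderiv ℝ φ v) := by
  have h1 := hφ.continuousAt.eventually (hF.eventually (by simp))
  filter_upwards [h1, hφ.eventually (by simp)] with v hv hv'
  exact fderiv_comp v (hv.differentiableAt (by norm_num)) (hv'.differentiableAt (by norm_num))

/-- The term containing the second derivative of `φ` lies in the image of `dF`, so it is tangential
and disappears from the mean curvature. -/
theorem partialDeriv_partialDeriv_comp (hF : ContDiffAt ℝ 2 F (φ u)) (hφ : ContDiffAt ℝ 2 φ u)
    (i j : Fin 2) :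
    partialDeriv (partialDeriv (F ∘ φ) j) i u =
      fderiv ℝ (fderiv ℝ F) (φ u) (fderiv ℝ φ u (stdVec i)) (fderiv ℝ φ u (stdVec j)) +
        fderiv ℝ F (φ u) (fderiv ℝ (fderiv ℝ φ) u (stdVec i) (stdVec j)) := by
  have e : partialDeriv (F ∘ φ) j =ᶠ[nhds u]
      fun v => fderiv ℝ F (φ v) (fderiv ℝ φ v (stdVec j)) := by
    filter_upwards [fderiv_comp_eventuallyEq hF hφ] with v hv
    rw [partialDeriv, hv, ContinuousLinearMap.comp_apply]
  have hφ' := (hφ.differentiableAt (by norm_num)).hasFDerivAt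
  have h1 := hF.differentiableAt_fderiv.hasFDerivAt.comp u hφ'
  have h2 := hφ.differentiableAt_fderiv.hasFDerivAt.clm_apply (hasFDerivAt_const (stdVec j) u)
  have h3 : fderiv ℝ (fun v => fderiv ℝ F (φ v) (fderiv ℝ φ v (stdVec j))) u = _ :=
    (h1.clm_apply h2).fderiv
  rw [partialDeriv, e.fderiv_eq, h3]
  simp [add_comm]

theorem det_ne_zero_of_injective {J : Plane →L[ℝ] Plane} (hJ : Function.Injective J) :
    J.det ≠ 0 := by
  have : LinearMap.ker (J : Plane →ₗ[ℝ] Plane) = ⊥ := LinearMap.ker_eq_bot.2 hJ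
  intro h
  exact (LinearMap.bot_lt_ker_of_det_eq_zero h).ne' this

/-- The mean curvature vector does not depend on the parametrisation. -/
theorem localMeanCurvature_comp (hF : ContDiffAt ℝ 2 F (φ u)) (hφ : ContDiffAt ℝ 2 φ u)
    (hJ : Function.Injective (fderiv ℝ φ u)) :
    localMeanCurvature (F ∘ φ) u = localMeanCurvature F (φ u) := by
  have hd := (fderiv_comp_eventuallyEq hF hφ).eq_of_nhds
  have hdet := det_ne_zero_of_injective hJ
  have ht : tangentPlane (F ∘ φ) u = tangentPlane F (φ u) := by
    have hs : LinearMap.range (fderiv ℝ φ u : Plane →ₗ[ℝ] Plane) = ⊤ :=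
      LinearMap.range_eq_top.2 (LinearMap.injective_iff_surjective.1 hJ)
    rw [tangentPlane_eq_range, tangentPlane_eq_range, hd, ContinuousLinearMap.toLinearMap_comp,
      LinearMap.range_comp_of_range_eq_top _ hs]
  have hM : hessianTrace (F ∘ φ) u - hessianTrace F (φ u) ∈ tangentPlane F (φ u) := by
    have := sum_gramMatrix_inv_comp (fderiv ℝ F (φ u)) (fderiv ℝ φ u) hdet
      (fderiv ℝ (fderiv ℝ F) (φ u))
    rw [hessianTrace, hessianTrace, metricMatrix_eq_gramMatrix, metricMatrix_eq_gramMatrix, hd]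
    simp only [partialDeriv_partialDeriv_comp hF hφ, partialDeriv_partialDeriv hF, smul_add,
      Finset.sum_add_distrib]
    rw [this, add_sub_cancel_left, tangentPlane_eq_range]
    exact Submodule.sum_mem _ fun _ _ => Submodule.sum_mem _ fun _ _ =>
      Submodule.smul_mem _ _ ⟨_, rfl⟩
  apply localMeanCurvature_eq_of
  · intro i
    refine inner_eq_zero_of_mem_tangentPlane (F := F) (u := φ u)
      (inner_localMeanCurvature_partialDeriv F (φ u)) ?_
    rw [← ht]
    exact partialDeriv_mem_tangentPlane _ _ _
  · rw [ht]
    have := Submodule.add_mem _ hM (hessianTrace_sub_localMeanCurvature_mem F (φ u))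
    rwa [sub_add_sub_cancel] at this

theorem areaDensity_comp (hF : DifferentiableAt ℝ F (φ u)) (hφ : DifferentiableAt ℝ φ u) :
    areaDensity (F ∘ φ) u = |(fderiv ℝ φ u).det| * areaDensity F (φ u) := by
  rw [areaDensity, areaDensity, metricMatrix_eq_gramMatrix, metricMatrix_eq_gramMatrix,
    fderiv_comp u hF hφ, gramMatrix_comp_det, Real.sqrt_mul (sq_nonneg _), Real.sqrt_sq_eq_abs]

/-- The pairing of the differential of `r` with `⟨F, dF⟩ / |F|²`, which is half the differential
of `log |F|²`, with respect to the metric of `F`. -/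
def localLogPairing (F : Plane → Ambient n) (r : Plane → ℝ) (u : Plane) : ℝ :=
  ∑ i : Fin 2, ∑ j : Fin 2, (metricMatrix F u)⁻¹ i j *
    (fderiv ℝ r u (stdVec i) * (inner ℝ (F u) (partialDeriv F j u) / ‖F u‖ ^ 2))

theorem localLogPairing_congr {r s : Plane → ℝ} (h : F =ᶠ[nhds u] G) (h' : r =ᶠ[nhds u] s) :
    localLogPairing F r u = localLogPairing G s u := by
  simp only [localLogPairing, metricMatrix_congr h, h'.fderiv_eq,
    (partialDeriv_congr h _).eq_of_nhds, h.eq_of_nhds]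

theorem localLogPairing_comp {r : Plane → ℝ} (hF : DifferentiableAt ℝ F (φ u))
    (hφ : DifferentiableAt ℝ φ u) (hr : DifferentiableAt ℝ r (φ u))
    (hJ : Function.Injective (fderiv ℝ φ u)) :
    localLogPairing (F ∘ φ) (r ∘ φ) u = localLogPairing F r (φ u) := by
  -- The pairing is the metric trace of the bilinear form `dr ⊗ (⟨F, dF⟩ / |F|²)`.
  have := sum_gramMatrix_inv_comp (fderiv ℝ F (φ u)) (fderiv ℝ φ u) (det_ne_zero_of_injective hJ)
    ((fderiv ℝ r (φ u)).smulRight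
      ((‖F (φ u)‖ ^ 2)⁻¹ • (innerSL ℝ (F (φ u))).comp (fderiv ℝ F (φ u))))
  simp only [ContinuousLinearMap.smulRight_apply, smul_apply, smul_eq_mul,
    ContinuousLinearMap.comp_apply, innerSL_apply_apply] at this
  simp only [localLogPairing, metricMatrix_eq_gramMatrix, partialDeriv, fderiv_comp u hF hφ,
    fderiv_comp u hr hφ, ContinuousLinearMap.comp_apply, Function.comp_apply, div_eq_inv_mul]
  exact this

end Reparametrisation

/-! ### Inversion of a local parametrisation -/

section Inversion

variable {n : ℕ} {F : Plane → Ambient n} {u : Plane}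

/-- Once differentiability is known, a partial derivative can be computed along a line, where the
one-variable product, quotient and root rules apply. -/
theorem fderiv_apply_eq_of_hasDerivAt {E : Type*} [NormedAddCommGroup E] [NormedSpace ℝ E]
    {H : Plane → E} {v : Plane} {y : E} (h : DifferentiableAt ℝ H u)
    (hd : HasDerivAt (fun t : ℝ => H (u + t • v)) y 0) : fderiv ℝ H u v = y := by
  rw [← h.lineDeriv_eq_fderiv]
  exact hd.deriv

theorem hasDerivAt_fderiv_apply {E : Type*} [NormedAddCommGroup E] [NormedSpace ℝ E]
    {H : Plane → E} (h : DifferentiableAt ℝ H u) (v : Plane) :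
    HasDerivAt (fun t : ℝ => H (u + t • v)) (fderiv ℝ H u v) 0 :=
  h.hasFDerivAt.hasLineDerivAt v

/-! ### The inversion is conformal. -/

theorem contDiffAt_inversion {x : Ambient n} (hx : x ≠ 0) {k : ℕ∞ω} :
    ContDiffAt ℝ k (inversion : Ambient n → Ambient n) x :=
  ((contDiff_norm_sq ℝ).contDiffAt.inv (by simpa using hx)).smul contDiffAt_id

theorem fderiv_inversion_apply {x : Ambient n} (hx : x ≠ 0) (w : Ambient n) :
    fderiv ℝ inversion x w =
      (‖x‖ ^ 2)⁻¹ • w - (2 * inner ℝ x w / (‖x‖ ^ 2) ^ 2) • x := by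
  have hq : ‖x‖ ^ 2 ≠ 0 := by simpa using hx
  have h1 : HasFDerivAt (fun y : Ambient n => ‖y‖ ^ 2) _ x := (hasFDerivAt_id x).norm_sq
  have h2 : HasFDerivAt (fun y : Ambient n => (‖y‖ ^ 2)⁻¹ • y) _ x :=
    ((hasDerivAt_inv hq).comp_hasFDerivAt x h1).smul (hasFDerivAt_id x)
  have e : fderiv ℝ inversion x = _ := h2.fderiv
  rw [e]
  simp
  module

/-- The reflection of `w` in the hyperplane orthogonal to `x`. -/
def reflectAlong (x : Ambient n) : Ambient n →ₗ[ℝ] Ambient n where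
  toFun w := w - (2 * inner ℝ x w / ‖x‖ ^ 2) • x
  map_add' v w := by rw [inner_add_right]; module
  map_smul' c w := by rw [inner_smul_right, RingHom.id_apply]; module

theorem reflectAlong_apply (x w : Ambient n) :
    reflectAlong x w = w - (2 * inner ℝ x w / ‖x‖ ^ 2) • x := rfl

theorem inner_reflectAlong {x : Ambient n} (hx : x ≠ 0) (v w : Ambient n) :
    inner ℝ (reflectAlong x v) (reflectAlong x w) = inner ℝ v w := by
  have hq : ‖x‖ ^ 2 ≠ 0 := by simpa using hx
  simp only [reflectAlong_apply, inner_sub_left, inner_sub_right, inner_smul_left,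
    inner_smul_right, conj_trivial, real_inner_self_eq_norm_sq, real_inner_comm x v]
  field_simp
  ring

theorem fderiv_inversion_eq_reflectAlong {x : Ambient n} (hx : x ≠ 0) (w : Ambient n) :
    fderiv ℝ inversion x w = (‖x‖ ^ 2)⁻¹ • reflectAlong x w := by
  rw [fderiv_inversion_apply hx, reflectAlong_apply, smul_sub, smul_smul]
  congr 2
  field_simp

theorem fderiv_inversion_injective {x : Ambient n} (hx : x ≠ 0) :
    Function.Injective (fderiv ℝ (inversion : Ambient n → Ambient n) x) := by
  rw [injective_iff_map_eq_zero]
  intro w hw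
  have hq : ‖x‖ ^ 2 ≠ 0 := by simpa using hx
  rw [fderiv_inversion_eq_reflectAlong hx, smul_eq_zero_iff_right (inv_ne_zero hq)] at hw
  have := inner_reflectAlong hx w w
  rw [hw, inner_zero_left] at this
  exact inner_self_eq_zero.1 this.symm

theorem fderiv_inversion_comp_apply (hF : DifferentiableAt ℝ F u) (h0 : F u ≠ 0) (v : Plane) :
    fderiv ℝ (inversion ∘ F) u v = (‖F u‖ ^ 2)⁻¹ • reflectAlong (F u) (fderiv ℝ F u v) := by
  rw [fderiv_comp u ((contDiffAt_inversion h0 (k := 1)).differentiableAt (by norm_num)) hF,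
    ContinuousLinearMap.comp_apply, fderiv_inversion_eq_reflectAlong h0]

theorem metricMatrix_inversion_comp (hF : DifferentiableAt ℝ F u) (h0 : F u ≠ 0) :
    metricMatrix (inversion ∘ F) u = ((‖F u‖ ^ 2) ^ 2)⁻¹ • metricMatrix F u := by
  ext i j
  simp only [metricMatrix, Matrix.of_apply, Matrix.smul_apply, partialDeriv,
    fderiv_inversion_comp_apply hF h0, inner_smul_left, inner_smul_right,
    inner_reflectAlong h0, smul_eq_mul, conj_trivial]
  ring

theorem areaDensity_inversion_comp (hF : DifferentiableAt ℝ F u) (h0 : F u ≠ 0) :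
    areaDensity (inversion ∘ F) u = ((‖F u‖ ^ 2) ^ 2)⁻¹ * areaDensity F u := by
  rw [areaDensity, areaDensity, metricMatrix_inversion_comp hF h0, Matrix.det_smul,
    Fintype.card_fin, Real.sqrt_mul (sq_nonneg _), Real.sqrt_sq (by positivity)]

theorem differentiableAt_partialDeriv (hF : ContDiffAt ℝ 2 F u) (j : Fin 2) :
    DifferentiableAt ℝ (partialDeriv F j) u :=
  hF.differentiableAt_fderiv.clm_apply (differentiableAt_const _)

theorem partialDeriv_partialDeriv_inversion_comp (hF : ContDiffAt ℝ 2 F u) (h0 : F u ≠ 0)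
    (i j : Fin 2) :
    partialDeriv (partialDeriv (inversion ∘ F) j) i u =
      (‖F u‖ ^ 2)⁻¹ • partialDeriv (partialDeriv F j) i u
      - (2 * inner ℝ (F u) (partialDeriv F i u) / (‖F u‖ ^ 2) ^ 2) • partialDeriv F j u
      - (2 * inner ℝ (F u) (partialDeriv F j u) / (‖F u‖ ^ 2) ^ 2) • partialDeriv F i u
      - (2 * (metricMatrix F u i j + inner ℝ (F u) (partialDeriv (partialDeriv F j) i u)) /
          (‖F u‖ ^ 2) ^ 2) • F u
      + (8 * inner ℝ (F u) (partialDeriv F i u) * inner ℝ (F u) (partialDeriv F j u) /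
          (‖F u‖ ^ 2) ^ 3) • F u := by
  have hq : ‖F u‖ ^ 2 ≠ 0 := by simpa using h0
  have hG : ContDiffAt ℝ 2 (inversion ∘ F) u := (contDiffAt_inversion h0).comp u hF
  have e : partialDeriv (inversion ∘ F) j =ᶠ[nhds u] fun v =>
      (‖F v‖ ^ 2)⁻¹ • partialDeriv F j v -
        (2 * inner ℝ (F v) (partialDeriv F j v) / (‖F v‖ ^ 2) ^ 2) • F v := by
    filter_upwards [hF.eventually (by simp), hF.continuousAt.eventually_ne h0] with v hv hv0
    rw [partialDeriv, fderiv_comp v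
      ((contDiffAt_inversion hv0 (k := 1)).differentiableAt (by norm_num))
      (hv.differentiableAt (by norm_num)), ContinuousLinearMap.comp_apply,
      fderiv_inversion_apply hv0]
    rfl
  -- Differentiability of the explicit expression is inherited from the regularity of `inversion ∘
  -- F`, leaving only the directional derivative to compute.
  have hd := (e.differentiableAt_iff (𝕜 := ℝ)).1 (differentiableAt_partialDeriv hG j)
  have d1 := hasDerivAt_fderiv_apply (hF.differentiableAt (by norm_num)) (stdVec i)
  have d2 := hasDerivAt_fderiv_apply (differentiableAt_partialDeriv hF j) (stdVec i)
  have d3 := d1.norm_sq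
  have d4 := d1.inner ℝ d2
  have d5 := ((d3.fun_inv (by simpa using h0)).fun_smul d2).fun_sub
    (((d4.const_mul 2).fun_div (d3.fun_pow 2) (by simpa using h0)).fun_smul d1)
  rw [partialDeriv, e.fderiv_eq, fderiv_apply_eq_of_hasDerivAt hd d5]
  change _ = (‖F u‖ ^ 2)⁻¹ • fderiv ℝ (partialDeriv F j) u (stdVec i)
      - (2 * inner ℝ (F u) (fderiv ℝ F u (stdVec i)) / (‖F u‖ ^ 2) ^ 2) • partialDeriv F j u
      - (2 * inner ℝ (F u) (partialDeriv F j u) / (‖F u‖ ^ 2) ^ 2) • fderiv ℝ F u (stdVec i)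
      - (2 * (inner ℝ (fderiv ℝ F u (stdVec i)) (partialDeriv F j u) +
          inner ℝ (F u) (fderiv ℝ (partialDeriv F j) u (stdVec i))) /
          (‖F u‖ ^ 2) ^ 2) • F u
      + (8 * inner ℝ (F u) (fderiv ℝ F u (stdVec i)) * inner ℝ (F u) (partialDeriv F j u) /
          (‖F u‖ ^ 2) ^ 3) • F u
  simp only [zero_smul, add_zero]
  match_scalars <;> field_simp <;> ring

/-! ### Mean curvature of the inverted surface. -/

theorem inv_metricMatrix_symm (F : Plane → Ambient n) (u : Plane) :
    (metricMatrix F u)⁻¹ 1 0 = (metricMatrix F u)⁻¹ 0 1 := by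
  obtain ⟨-, h01, h10, -⟩ := inv_fin_two_apply (metricMatrix F u)
  rw [h01, h10, metricMatrix_symm]

theorem sum_inv_metricMatrix_mul (hF : Function.Injective (fderiv ℝ F u)) :
    ∑ i, ∑ j, (metricMatrix F u)⁻¹ i j * metricMatrix F u i j = 2 := by
  have hD := (metricMatrix_det_pos hF).ne'
  obtain ⟨h00, h01, h10, h11⟩ := inv_fin_two_apply (metricMatrix F u)
  have e : (metricMatrix F u).det = _ := Matrix.det_fin_two _
  simp only [Fin.sum_univ_two, h00, h01, h10, h11, metricMatrix_symm F u 1 0] at e ⊢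
  field_simp
  rw [e]
  ring

theorem inv_smul_metricMatrix {c : ℝ} (hc : c ≠ 0) (g : Matrix (Fin 2) (Fin 2) ℝ) :
    (c⁻¹ • g)⁻¹ = c • g⁻¹ := by
  by_cases hg : g.det = 0
  · rw [Matrix.nonsing_inv_apply_not_isUnit _ (by simp [hg]),
      Matrix.nonsing_inv_apply_not_isUnit _ (by simp [hg]), smul_zero]
  · refine Matrix.inv_eq_left_inv ?_
    rw [Matrix.smul_mul, Matrix.mul_smul, smul_smul, mul_inv_cancel₀ hc, one_smul,
      Matrix.nonsing_inv_mul _ (isUnit_iff_ne_zero.2 hg)]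

theorem inner_tangentialPart (F : Plane → Ambient n) (u : Plane) (v w : Ambient n) :
    inner ℝ v (tangentialPart F u w) = ∑ i, ∑ j, (metricMatrix F u)⁻¹ i j *
      inner ℝ w (partialDeriv F i u) * inner ℝ v (partialDeriv F j u) := by
  simp only [tangentialPart, inner_sum, inner_smul_right]

/-- The inverse metric of `inversion ∘ F` is `|F|⁴ g⁻¹`. In the traced second derivatives the two
mixed terms give `-4 F^T`, and the trace `gⁱʲ gᵢⱼ = 2` gives `-4 F`, which is the reflection of `4
F`. -/
theorem hessianTrace_inversion_comp (hF : ContDiffAt ℝ 2 F u) (h0 : F u ≠ 0)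
    (hi : Function.Injective (fderiv ℝ F u)) :
    hessianTrace (inversion ∘ F) u = reflectAlong (F u)
      (‖F u‖ ^ 2 • hessianTrace F u + (4 : ℝ) • (F u - tangentialPart F u (F u))) := by
  have hq : ‖F u‖ ^ 2 ≠ 0 := by simpa using h0
  have hK := sum_inv_metricMatrix_mul hi
  rw [reflectAlong_apply, inner_add_right, inner_smul_right, inner_smul_right, inner_sub_right,
    inner_tangentialPart, real_inner_self_eq_norm_sq]
  simp only [hessianTrace, metricMatrix_inversion_comp (hF.differentiableAt (by norm_num)) h0,
    inv_smul_metricMatrix (pow_ne_zero 2 hq), partialDeriv_partialDeriv_inversion_comp hF h0,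
    inner_add_right, inner_smul_right, Fin.sum_univ_two, tangentialPart, Matrix.smul_apply,
    smul_eq_mul,
    inv_metricMatrix_symm, metricMatrix_symm F u 1 0] at hK ⊢
  generalize metricMatrix F u = g at *
  generalize ‖F u‖ ^ 2 = q at *
  -- The dimension of the surface enters through `hK`, in the coefficient of `F u`.
  match_scalars <;> field_simp <;>
    first | ring1 | linear_combination (-2) * hK | linear_combination (-2 * q) * hK

theorem localMeanCurvature_inversion_comp (hF : ContDiffAt ℝ 2 F u) (h0 : F u ≠ 0)
    (hi : Function.Injective (fderiv ℝ F u)) :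
    localMeanCurvature (inversion ∘ F) u = reflectAlong (F u)
      (‖F u‖ ^ 2 • localMeanCurvature F u + (4 : ℝ) • (F u - tangentialPart F u (F u))) := by
  have hq : ‖F u‖ ^ 2 ≠ 0 := by simpa using h0
  have hd := hF.differentiableAt (by norm_num)
  apply localMeanCurvature_eq_of
  · intro i
    rw [partialDeriv, fderiv_inversion_comp_apply hd h0, inner_smul_right, inner_reflectAlong h0,
      inner_add_left, inner_smul_left, inner_smul_left, inner_sub_left]
    have h1 := inner_localMeanCurvature_partialDeriv F u i
    have h2 := inner_tangentialPart_partialDeriv hi (F u) i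
    simp only [partialDeriv] at h1 h2
    rw [h1, h2]
    simp
  · have h := hessianTrace_sub_localMeanCurvature_mem F u
    rw [tangentPlane_eq_range] at h ⊢
    obtain ⟨v, hv⟩ := h
    rw [hessianTrace_inversion_comp hF h0 hi, ← map_sub, add_sub_add_right_eq_sub, ← smul_sub,
      ← hv, map_smul]
    -- One factor `|F|²` is the weight of the Hessian trace; the other compensates the conformal
    -- factor `|F|⁻²` of the differential.
    refine ⟨((‖F u‖ ^ 2) ^ 2) • v, ?_⟩
    simp only [ContinuousLinearMap.coe_coe, map_smul, fderiv_inversion_comp_apply hd h0, smul_smul]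
    congr 1
    field_simp

/-- The change of the Willmore integrand under inversion. -/
theorem norm_localMeanCurvature_inversion_comp (hF : ContDiffAt ℝ 2 F u) (h0 : F u ≠ 0)
    (hi : Function.Injective (fderiv ℝ F u)) :
    areaDensity (inversion ∘ F) u * ‖localMeanCurvature (inversion ∘ F) u‖ ^ 2 =
      areaDensity F u * (‖localMeanCurvature F u‖ ^ 2 +
        8 * (inner ℝ (localMeanCurvature F u) (F u) / ‖F u‖ ^ 2 +
          2 * (‖F u‖ ^ 2 - inner ℝ (F u) (tangentialPart F u (F u))) / (‖F u‖ ^ 2) ^ 2)) := by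
  have hq : ‖F u‖ ^ 2 ≠ 0 := by simpa using h0
  have h1 : inner ℝ (localMeanCurvature F u) (tangentialPart F u (F u)) = 0 :=
    inner_eq_zero_of_mem_tangentPlane (inner_localMeanCurvature_partialDeriv F u)
      (tangentialPart_mem F u _)
  -- Orthogonality of `F^⊥` and `F^T` gives `|F^⊥|² = |F|² - ⟨F, F^T⟩`, the form in which the normal
  -- part enters the statement.
  have h2 : inner ℝ (F u - tangentialPart F u (F u)) (tangentialPart F u (F u)) = 0 := by
    refine inner_eq_zero_of_mem_tangentPlane (fun i => ?_) (tangentialPart_mem F u _)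
    rw [inner_sub_left, inner_tangentialPart_partialDeriv hi, sub_self]
  rw [inner_sub_left, sub_eq_zero] at h2
  rw [areaDensity_inversion_comp (hF.differentiableAt (by norm_num)) h0,
    localMeanCurvature_inversion_comp hF h0 hi, ← real_inner_self_eq_norm_sq (reflectAlong _ _),
    inner_reflectAlong h0]
  simp only [inner_add_left, inner_add_right, inner_sub_left, inner_sub_right, inner_smul_left,
    inner_smul_right, conj_trivial, h1, ← h2, real_inner_self_eq_norm_sq,
    real_inner_comm (localMeanCurvature F u), real_inner_comm (F u) (tangentialPart F u (F u))]
  field_simp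
  ring

end Inversion

/-! ### Regularity of the local quantities -/

section Regularity

variable {n : ℕ} {F : Plane → Ambient n} {Ω : Set Plane}

/-- A local parametrisation of a `C²` immersed surface, defined on an open set. -/
structure IsLocalImmersion (F : Plane → Ambient n) (Ω : Set Plane) : Prop where
  isOpen : IsOpen Ω
  contDiffOn : ContDiffOn ℝ 2 F Ω
  injective : ∀ u ∈ Ω, Function.Injective (fderiv ℝ F u)

namespace IsLocalImmersion

theorem contDiffAt (h : IsLocalImmersion F Ω) {u : Plane} (hu : u ∈ Ω) : ContDiffAt ℝ 2 F u :=
  h.contDiffOn.contDiffAt (h.isOpen.mem_nhds hu)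

theorem contDiffOn_partialDeriv (h : IsLocalImmersion F Ω) (i : Fin 2) :
    ContDiffOn ℝ 1 (partialDeriv F i) Ω :=
  (h.contDiffOn.fderiv_of_isOpen h.isOpen (by norm_num)).clm_apply contDiffOn_const

theorem continuousOn_partialDeriv_partialDeriv (h : IsLocalImmersion F Ω) (i j : Fin 2) :
    ContinuousOn (partialDeriv (partialDeriv F j) i) Ω :=
  ((h.contDiffOn_partialDeriv j).continuousOn_fderiv_of_isOpen h.isOpen (by norm_num)).clm_apply
    continuousOn_const

theorem contDiffOn_metricMatrix (h : IsLocalImmersion F Ω) (i j : Fin 2) :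
    ContDiffOn ℝ 1 (fun u => metricMatrix F u i j) Ω :=
  (h.contDiffOn_partialDeriv i).inner ℝ (h.contDiffOn_partialDeriv j)

theorem det_pos (h : IsLocalImmersion F Ω) {u : Plane} (hu : u ∈ Ω) :
    0 < (metricMatrix F u).det := metricMatrix_det_pos (h.injective u hu)

theorem contDiffOn_det (h : IsLocalImmersion F Ω) :
    ContDiffOn ℝ 1 (fun u => (metricMatrix F u).det) Ω := by
  simp only [Matrix.det_fin_two]
  exact ((h.contDiffOn_metricMatrix 0 0).mul (h.contDiffOn_metricMatrix 1 1)).sub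
    ((h.contDiffOn_metricMatrix 0 1).mul (h.contDiffOn_metricMatrix 1 0))

theorem contDiffOn_areaDensity (h : IsLocalImmersion F Ω) : ContDiffOn ℝ 1 (areaDensity F) Ω :=
  h.contDiffOn_det.sqrt fun _ hu => (h.det_pos hu).ne'

theorem contDiffOn_inv (h : IsLocalImmersion F Ω) (i j : Fin 2) :
    ContDiffOn ℝ 1 (fun u => (metricMatrix F u)⁻¹ i j) Ω := by
  have hD := h.contDiffOn_det
  have h0 : ∀ u ∈ Ω, (metricMatrix F u).det ≠ 0 := fun _ hu => (h.det_pos hu).ne'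
  have hi (u : Plane) := inv_fin_two_apply (metricMatrix F u)
  have hg := h.contDiffOn_metricMatrix
  fin_cases i <;> fin_cases j
  · exact ((hg 1 1).div hD h0).congr fun u _ => (hi u).1
  · exact ((hg 0 1).neg.div hD h0).congr fun u _ => (hi u).2.1
  · exact ((hg 1 0).neg.div hD h0).congr fun u _ => (hi u).2.2.1
  · exact ((hg 0 0).div hD h0).congr fun u _ => (hi u).2.2.2

theorem localMeanCurvature_eq_tangentialPart (h : IsLocalImmersion F Ω) {u : Plane} (hu : u ∈ Ω) :
    localMeanCurvature F u = hessianTrace F u - tangentialPart F u (hessianTrace F u) := by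
  rw [localMeanCurvature_eq, starProjection_tangentPlane (h.injective u hu)]

/-- The second derivatives of `F` are continuous, and the tangential projection is replaced by its
formula in terms of `g⁻¹` and the first derivatives. -/
theorem continuousOn_localMeanCurvature (h : IsLocalImmersion F Ω) :
    ContinuousOn (localMeanCurvature F) Ω := by
  have hM : ContinuousOn (hessianTrace F) Ω :=
    continuousOn_finsetSum _ fun i _ => continuousOn_finsetSum _ fun j _ =>
      (h.contDiffOn_inv i j).continuousOn.smul (h.continuousOn_partialDeriv_partialDeriv i j)
  have hT : ContinuousOn (fun u => tangentialPart F u (hessianTrace F u)) Ω :=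
    continuousOn_finsetSum _ fun i _ => continuousOn_finsetSum _ fun j _ =>
      ((h.contDiffOn_inv i j).continuousOn.mul
        (hM.inner (h.contDiffOn_partialDeriv i).continuousOn)).smul
        (h.contDiffOn_partialDeriv j).continuousOn
  exact (hM.sub hT).congr fun u hu => h.localMeanCurvature_eq_tangentialPart hu

theorem contDiffOn_logDifferential (h : IsLocalImmersion F Ω) (h0 : ∀ u ∈ Ω, F u ≠ 0)
    (j : Fin 2) :
    ContDiffOn ℝ 1 (fun u => inner ℝ (F u) (partialDeriv F j u) / ‖F u‖ ^ 2) Ω := by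
  have hF := h.contDiffOn.of_le (m := 1) (by norm_num)
  exact (hF.inner ℝ (h.contDiffOn_partialDeriv j)).div (hF.norm_sq ℝ)
    fun u hu => by simpa using h0 u hu

theorem continuousOn_localLogPairing (h : IsLocalImmersion F Ω) (h0 : ∀ u ∈ Ω, F u ≠ 0)
    {r : Plane → ℝ} (hr : ContDiffOn ℝ 1 r Ω) : ContinuousOn (localLogPairing F r) Ω :=
  continuousOn_finsetSum _ fun i _ => continuousOn_finsetSum _ fun j _ =>
    (h.contDiffOn_inv i j).continuousOn.mul
      (((hr.continuousOn_fderiv_of_isOpen h.isOpen (by norm_num)).clm_apply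
        continuousOn_const).mul (h.contDiffOn_logDifferential h0 j).continuousOn)

end IsLocalImmersion

/-- The components of the vector density `√g gⁱʲ ⟨F, ∂ⱼ F⟩ / |F|²`. -/
def logField (F : Plane → Ambient n) (i : Fin 2) (u : Plane) : ℝ :=
  areaDensity F u * ∑ j, (metricMatrix F u)⁻¹ i j *
    (inner ℝ (F u) (partialDeriv F j u) / ‖F u‖ ^ 2)

theorem IsLocalImmersion.contDiffOn_logField (h : IsLocalImmersion F Ω)
    (h0 : ∀ u ∈ Ω, F u ≠ 0) (i : Fin 2) : ContDiffOn ℝ 1 (logField F i) Ω :=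
  h.contDiffOn_areaDensity.mul <| ContDiffOn.sum fun j _ =>
    (h.contDiffOn_inv i j).mul (h.contDiffOn_logDifferential h0 j)

theorem areaDensity_mul_localLogPairing (F : Plane → Ambient n) (r : Plane → ℝ) (u : Plane) :
    areaDensity F u * localLogPairing F r u =
      ∑ i, fderiv ℝ r u (stdVec i) * logField F i u := by
  simp only [localLogPairing, logField, Fin.sum_univ_two]
  ring

/-- With `det g` written as the square of the area density, each component becomes a single quotient
that is easy to differentiate. The formula holds at degenerate points too, where both sides vanish
by the convention on division by zero. -/
theorem logField_eq (F : Plane → Ambient n) (u : Plane) :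
    logField F 0 u = (metricMatrix F u 1 1 * inner ℝ (F u) (partialDeriv F 0 u) -
        metricMatrix F u 0 1 * inner ℝ (F u) (partialDeriv F 1 u)) /
          (areaDensity F u * ‖F u‖ ^ 2) ∧
      logField F 1 u = (metricMatrix F u 0 0 * inner ℝ (F u) (partialDeriv F 1 u) -
        metricMatrix F u 0 1 * inner ℝ (F u) (partialDeriv F 0 u)) /
          (areaDensity F u * ‖F u‖ ^ 2) := by
  obtain ⟨h00, h01, h10, h11⟩ := inv_fin_two_apply (metricMatrix F u)
  have hD : (metricMatrix F u).det = areaDensity F u ^ 2 := by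
    have : (metricMatrix F u).PosSemidef :=
      Matrix.posSemidef_gram ℝ fun i => partialDeriv F i u
    exact (Real.sq_sqrt this.det_nonneg).symm
  simp only [logField, Fin.sum_univ_two, h00, h01, h10, h11, hD, metricMatrix_symm F u 1 0]
  by_cases hs : areaDensity F u = 0
  · simp [hs]
  by_cases hq : ‖F u‖ = 0
  · simp [hq]
  constructor <;> (field_simp; ring)

/-- This is the formula for the Laplacian of `log |F|`, which rests on the Laplacian of the position
vector `F` being its mean curvature vector. It is verified here by direct differentiation in
coordinates. -/
theorem IsLocalImmersion.divergence_logField (h : IsLocalImmersion F Ω) (h0 : ∀ u ∈ Ω, F u ≠ 0)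
    {u : Plane} (hu : u ∈ Ω) :
    ∑ i, fderiv ℝ (logField F i) u (stdVec i) =
      areaDensity F u * (inner ℝ (localMeanCurvature F u) (F u) / ‖F u‖ ^ 2 +
          2 * (‖F u‖ ^ 2 - inner ℝ (F u) (tangentialPart F u (F u))) / (‖F u‖ ^ 2) ^ 2) := by
  have hF := h.contDiffAt hu
  have hq : ‖F u‖ ^ 2 ≠ 0 := by simpa using h0 u hu
  have hD := (h.det_pos hu)
  have hs : areaDensity F u ≠ 0 := (Real.sqrt_pos.2 hD).ne'
  have hdiff (i : Fin 2) : DifferentiableAt ℝ (logField F i) u :=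
    ((h.contDiffOn_logField h0 i).contDiffAt (h.isOpen.mem_nhds hu)).differentiableAt (by norm_num)
  have dF (i : Fin 2) := hasDerivAt_fderiv_apply (hF.differentiableAt (by norm_num)) (stdVec i)
  have dX (i j : Fin 2) := hasDerivAt_fderiv_apply (differentiableAt_partialDeriv hF j) (stdVec i)
  have dq (i : Fin 2) := (dF i).norm_sq
  have dp (i j : Fin 2) := (dF i).inner ℝ (dX i j)
  have dg (i j k : Fin 2) := (dX i j).inner ℝ (dX i k)
  have dD (i : Fin 2) := ((dg i 0 0).fun_mul (dg i 1 1)).fun_sub ((dg i 0 1).fun_mul (dg i 1 0))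
  have hD' (v : Plane) : (metricMatrix F v).det =
      inner ℝ (partialDeriv F 0 v) (partialDeriv F 0 v) *
        inner ℝ (partialDeriv F 1 v) (partialDeriv F 1 v) -
      inner ℝ (partialDeriv F 0 v) (partialDeriv F 1 v) *
        inner ℝ (partialDeriv F 1 v) (partialDeriv F 0 v) := Matrix.det_fin_two _
  have ds (i : Fin 2) := (dD i).sqrt (by
    rw [← hD', zero_smul, add_zero]; exact hD.ne')
  simp only [← hD'] at ds
  have hsq (i : Fin 2) : √(metricMatrix F (u + (0 : ℝ) • stdVec i)).det *
      ‖F (u + (0 : ℝ) • stdVec i)‖ ^ 2 ≠ 0 := by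
    rw [zero_smul, add_zero]; exact mul_ne_zero hs hq
  have d0 := (((dg 0 1 1).fun_mul (dp 0 0)).fun_sub ((dg 0 0 1).fun_mul (dp 0 1))).fun_div
    ((ds 0).fun_mul (dq 0)) (hsq 0)
  have d1 := (((dg 1 0 0).fun_mul (dp 1 1)).fun_sub ((dg 1 0 1).fun_mul (dp 1 0))).fun_div
    ((ds 1).fun_mul (dq 1)) (hsq 1)
  have e0 : fderiv ℝ (logField F 0) u (stdVec 0) = _ :=
    fderiv_apply_eq_of_hasDerivAt (hdiff 0) (d0.congr_of_eventuallyEq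
      (Filter.Eventually.of_forall fun t => (logField_eq F _).1))
  have e1 : fderiv ℝ (logField F 1) u (stdVec 1) = _ :=
    fderiv_apply_eq_of_hasDerivAt (hdiff 1) (d1.congr_of_eventuallyEq
      (Filter.Eventually.of_forall fun t => (logField_eq F _).2))
  rw [Fin.sum_univ_two, e0, e1, h.localMeanCurvature_eq_tangentialPart hu, inner_sub_left,
    real_inner_comm (F u) (tangentialPart _ _ _), inner_tangentialPart, inner_tangentialPart]
  obtain ⟨i00, i01, i10, i11⟩ := inv_fin_two_apply (metricMatrix F u)
  have hd2 := Matrix.det_fin_two (metricMatrix F u)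
  have hs2 : areaDensity F u ^ 2 = (metricMatrix F u).det := Real.sq_sqrt hD.le
  have hg (i j : Fin 2) : inner ℝ (partialDeriv F i u) (partialDeriv F j u) =
    metricMatrix F u i j := rfl
  have hX (i : Fin 2) : fderiv ℝ F u (stdVec i) = partialDeriv F i u := rfl
  have hB (i j : Fin 2) : fderiv ℝ (partialDeriv F j) u (stdVec i) =
    partialDeriv (partialDeriv F j) i u := rfl
  have c1 (i j k : Fin 2) : inner ℝ (partialDeriv (partialDeriv F j) i u) (partialDeriv F k u) =
    inner ℝ (partialDeriv F k u) (partialDeriv (partialDeriv F j) i u) := real_inner_comm _ _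
  have c2 (i j : Fin 2) : inner ℝ (partialDeriv (partialDeriv F j) i u) (F u) =
    inner ℝ (F u) (partialDeriv (partialDeriv F j) i u) := real_inner_comm _ _
  have ha : √(metricMatrix F u).det = areaDensity F u := rfl
  simp only [hessianTrace, Fin.sum_univ_two, zero_smul, add_zero, hX, hB, ha, hg, inner_add_left,
    inner_smul_left, conj_trivial, partialDeriv_partialDeriv_comm hF 1 0,
    metricMatrix_symm F u 1 0, i00, i01, i10, i11,
    c1, c2] at hd2 ⊢
  rw [hd2] at hs2
  rw [← hs2] at hd2
  rw [hd2]
  clear * - hs2 hs hq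
  generalize inner ℝ (partialDeriv F 0 u) (partialDeriv (partialDeriv F 0) 0 u) = b000 at *
  generalize inner ℝ (partialDeriv F 0 u) (partialDeriv (partialDeriv F 1) 0 u) = b010 at *
  generalize inner ℝ (partialDeriv F 0 u) (partialDeriv (partialDeriv F 1) 1 u) = b110 at *
  generalize inner ℝ (partialDeriv F 1 u) (partialDeriv (partialDeriv F 0) 0 u) = b001 at *
  generalize inner ℝ (partialDeriv F 1 u) (partialDeriv (partialDeriv F 1) 0 u) = b011 at *
  generalize inner ℝ (partialDeriv F 1 u) (partialDeriv (partialDeriv F 1) 1 u) = b111 at *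
  generalize metricMatrix F u 0 0 = a at *
  generalize metricMatrix F u 0 1 = b at *
  generalize metricMatrix F u 1 1 = c at *
  generalize areaDensity F u = s at *
  generalize ‖F u‖ ^ 2 = q at *
  -- The only relation among the remaining quantities is `s² = a c - b²`. As `s ≠ 0` it forces `a ≠
  -- 0`, so `c` can be eliminated and a rational identity in free variables remains.
  have ha : a ≠ 0 := by
    rintro rfl
    nlinarith [sq_nonneg b, sq_pos_of_ne_zero hs]
  obtain rfl : c = (s ^ 2 + b ^ 2) / a := by
    rw [hs2]; field_simp; ring
  field_simp
  ring

end Regularity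

/-! ### Integration by parts in the parameter plane -/

section Divergence

variable {n : ℕ} {F : Plane → Ambient n} {Ω K : Set Plane}

theorem integrableOn_of_continuousOn_of_eq_zero {w : Plane → ℝ} (hΩ : IsOpen Ω)
    (hK : IsCompact K) (hKΩ : K ⊆ Ω) (hw : ContinuousOn w Ω) (h0 : ∀ u ∈ Ω, u ∉ K → w u = 0) :
    IntegrableOn w Ω :=
  ((hw.mono hKΩ).integrableOn_compact hK).of_forall_sdiff_eq_zero hΩ.measurableSet
    fun u hu => h0 u hu.1 hu.2

/-- Extension by zero outside `Ω` gives a compactly supported `C¹` function on the whole plane, and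
integration by parts against the constant `1` applies. The indicator is needed because nothing is
assumed about `w` outside `Ω`. -/
theorem setIntegral_fderiv_eq_zero {w : Plane → ℝ} (hΩ : IsOpen Ω)
    (hK : IsCompact K) (hKΩ : K ⊆ Ω) (hw : ContDiffOn ℝ 1 w Ω) (h0 : ∀ u ∈ Ω, u ∉ K → w u = 0)
    (v : Plane) : ∫ u in Ω, fderiv ℝ w u v = 0 := by
  set W := Ω.indicator w with hW
  have hW0 : ∀ u ∉ K, W u = 0 := by
    intro u hu
    by_cases hΩu : u ∈ Ω
    · rw [hW, Set.indicator_of_mem hΩu, h0 u hΩu hu]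
    · exact Set.indicator_of_notMem hΩu _
  have hWw {u : Plane} (hu : u ∈ Ω) : W =ᶠ[nhds u] w := by
    filter_upwards [hΩ.mem_nhds hu] with x hx
    exact Set.indicator_of_mem hx _
  have hW1 : ContDiff ℝ 1 W := by
    rw [contDiff_iff_contDiffAt]
    intro u
    by_cases hu : u ∈ Ω
    · exact (hw.contDiffAt (hΩ.mem_nhds hu)).congr_of_eventuallyEq (hWw hu)
    · refine (contDiffAt_const (c := (0 : ℝ))).congr_of_eventuallyEq ?_
      filter_upwards [hK.isClosed.isOpen_compl.mem_nhds fun h => hu (hKΩ h)] with x hx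
      exact hW0 x hx
  have hWc : HasCompactSupport W := HasCompactSupport.intro hK hW0
  have hdc : HasCompactSupport fun u => fderiv ℝ W u v := hWc.fderiv_apply (𝕜 := ℝ) v
  have hcont : Continuous fun u => fderiv ℝ W u v :=
    (hW1.continuous_fderiv (by norm_num)).clm_apply continuous_const
  have key := integral_mul_fderiv_eq_neg_fderiv_mul_of_integrable (μ := (volume : Measure Plane))
    (f := fun _ => (1 : ℝ)) (g := W) (v := v) (by simp)
    (by simpa using hcont.integrable_of_hasCompactSupport hdc)
    (by simpa using hW1.continuous.integrable_of_hasCompactSupport hWc)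
    (fun x _ => differentiableAt_const _)
    (fun x _ => hW1.contDiffAt.differentiableAt (by norm_num))
  simp only [one_mul, fderiv_fun_const, Pi.zero_apply, zero_apply, zero_mul,
    integral_zero, neg_zero] at key
  rw [← key]
  refine (setIntegral_congr_fun hΩ.measurableSet fun u hu => ?_).trans
    (setIntegral_eq_integral_of_forall_compl_eq_zero fun u hu => ?_)
  · exact congrArg (fun T : Plane →L[ℝ] ℝ => T v) (hWw hu).fderiv_eq.symm
  · have : W =ᶠ[nhds u] fun _ => 0 := by
      filter_upwards [hK.isClosed.isOpen_compl.mem_nhds fun h => hu (hKΩ h)] with x hx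
      exact hW0 x hx
    simp [this.fderiv_eq]

theorem IsLocalImmersion.inversion_comp (h : IsLocalImmersion F Ω) (h0 : ∀ u ∈ Ω, F u ≠ 0) :
    IsLocalImmersion (inversion ∘ F) Ω where
  isOpen := h.isOpen
  contDiffOn u hu := ((contDiffAt_inversion (h0 u hu)).comp u (h.contDiffAt hu)).contDiffWithinAt
  injective u hu := by
    rw [fderiv_comp u ((contDiffAt_inversion (h0 u hu) (k := 1)).differentiableAt (by norm_num))
      ((h.contDiffAt hu).differentiableAt (by norm_num))]
    exact (fderiv_inversion_injective (h0 u hu)).comp (h.injective u hu)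

/-- The local form of the invariance of the Willmore energy, tested against a function. -/
theorem IsLocalImmersion.setIntegral_inversion_comp (h : IsLocalImmersion F Ω)
    (h0 : ∀ u ∈ Ω, F u ≠ 0) (hK : IsCompact K) (hKΩ : K ⊆ Ω) {r : Plane → ℝ}
    (hr : ContDiffOn ℝ 1 r Ω) (hr0 : ∀ u ∈ Ω, u ∉ K → r u = 0) :
    ∫ u in Ω, areaDensity (inversion ∘ F) u *
        (r u * ‖localMeanCurvature (inversion ∘ F) u‖ ^ 2) =
      (∫ u in Ω, areaDensity F u * (r u * ‖localMeanCurvature F u‖ ^ 2)) -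
        8 * ∫ u in Ω, areaDensity F u * localLogPairing F r u := by
  have hΩ := h.isOpen
  have hr' : ∀ u ∈ Ω, u ∉ K → fderiv ℝ r u = 0 := by
    intro u hu hu'
    have : r =ᶠ[nhds u] fun _ => 0 := by
      filter_upwards [hK.isClosed.isOpen_compl.mem_nhds hu', hΩ.mem_nhds hu] with x hx hx'
      exact hr0 x hx' hx
    simp [this.fderiv_eq]
  have hV := h.contDiffOn_logField h0
  have hrV (i : Fin 2) : ContDiffOn ℝ 1 (fun u => r u * logField F i u) Ω := hr.mul (hV i)
  have hrV0 (i : Fin 2) : ∀ u ∈ Ω, u ∉ K → r u * logField F i u = 0 := fun u hu hu' => by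
    rw [hr0 u hu hu', zero_mul]
  have hz (i : Fin 2) := setIntegral_fderiv_eq_zero hΩ hK hKΩ (hrV i) (hrV0 i) (stdVec i)
  have hint (i : Fin 2) :
      IntegrableOn (fun u => fderiv ℝ (fun u => r u * logField F i u) u (stdVec i)) Ω := by
    refine integrableOn_of_continuousOn_of_eq_zero hΩ hK hKΩ
      (((hrV i).continuousOn_fderiv_of_isOpen hΩ (by norm_num)).clm_apply continuousOn_const) ?_
    intro u hu hu'
    have : (fun u => r u * logField F i u) =ᶠ[nhds u] fun _ => 0 := by
      filter_upwards [hK.isClosed.isOpen_compl.mem_nhds hu', hΩ.mem_nhds hu] with x hx hx'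
      exact hrV0 i x hx' hx
    simp [this.fderiv_eq]
  have hI1 : IntegrableOn (fun u => areaDensity F u * (r u * ‖localMeanCurvature F u‖ ^ 2)) Ω := by
    refine integrableOn_of_continuousOn_of_eq_zero hΩ hK hKΩ
      (h.contDiffOn_areaDensity.continuousOn.mul
        (hr.continuousOn.mul (h.continuousOn_localMeanCurvature.norm.pow 2))) ?_
    intro u hu hu'
    rw [hr0 u hu hu']; ring
  have hI2 : IntegrableOn (fun u => areaDensity F u * localLogPairing F r u) Ω := by
    refine integrableOn_of_continuousOn_of_eq_zero hΩ hK hKΩ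
      (h.contDiffOn_areaDensity.continuousOn.mul (h.continuousOn_localLogPairing h0 hr)) ?_
    intro u hu hu'
    simp [localLogPairing, hr' u hu hu']
  have hsum : ∫ u in Ω, ∑ i, fderiv ℝ (fun u => r u * logField F i u) u (stdVec i) = 0 := by
    rw [integral_finsetSum _ fun i _ => hint i]
    simp [hz]
  have hIs : IntegrableOn
      (fun u => ∑ i, fderiv ℝ (fun u => r u * logField F i u) u (stdVec i)) Ω :=
    integrable_finsetSum _ fun i _ => hint i
  have hI3 : IntegrableOn (fun u => areaDensity F u * (r u * ‖localMeanCurvature F u‖ ^ 2) +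
      8 * ∑ i, fderiv ℝ (fun u => r u * logField F i u) u (stdVec i)) Ω :=
    Integrable.add hI1 (hIs.const_mul 8)
  -- The pointwise law contributes `8 r div V`, rewritten as `8 div (r V) - 8 ⟨dr, V⟩`; the first
  -- term integrates to zero.
  have hpt : ∀ u ∈ Ω, areaDensity (inversion ∘ F) u *
        (r u * ‖localMeanCurvature (inversion ∘ F) u‖ ^ 2) =
      areaDensity F u * (r u * ‖localMeanCurvature F u‖ ^ 2) +
        8 * ∑ i, fderiv ℝ (fun u => r u * logField F i u) u (stdVec i) -
        8 * (areaDensity F u * localLogPairing F r u) := by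
    intro u hu
    have e1 := norm_localMeanCurvature_inversion_comp (h.contDiffAt hu) (h0 u hu) (h.injective u hu)
    have e2 := h.divergence_logField h0 hu
    have e3 (i : Fin 2) : fderiv ℝ (fun u => r u * logField F i u) u (stdVec i) =
        r u * fderiv ℝ (logField F i) u (stdVec i) + fderiv ℝ r u (stdVec i) * logField F i u := by
      rw [fderiv_fun_mul ((hr.contDiffAt (hΩ.mem_nhds hu)).differentiableAt (by norm_num))
        (((hV i).contDiffAt (hΩ.mem_nhds hu)).differentiableAt (by norm_num))]
      simp [mul_comm]
    rw [areaDensity_mul_localLogPairing]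
    simp only [e3, Finset.sum_add_distrib, ← Finset.mul_sum]
    rw [e2]
    linear_combination r u * e1
  rw [setIntegral_congr_fun hΩ.measurableSet hpt, integral_sub hI3 (hI2.const_mul 8),
    integral_add hI1 (hIs.const_mul 8), integral_const_mul,
    integral_const_mul, hsum]
  ring

end Divergence

/-! ### Passing between charts of a surface -/

section Charts

variable {n : ℕ} {S : Type*} [TopologicalSpace S] {f : S → Ambient n}
  {e e' : OpenPartialHomeomorph S Plane}

theorem eventually_mem_source_transition {u : Plane} (hu : u ∈ e'.target)
    (hu' : e'.symm u ∈ e.source) : ∀ᶠ v in nhds u, e'.symm v ∈ e.source :=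
  (e'.continuousAt_symm hu).eventually (e.open_source.mem_nhds hu')

theorem comp_transition_eventuallyEq {E : Type*} (g : S → E) {u : Plane} (hu : u ∈ e'.target)
    (hu' : e'.symm u ∈ e.source) :
    g ∘ e'.symm =ᶠ[nhds u] (g ∘ e.symm) ∘ (e ∘ e'.symm) := by
  filter_upwards [eventually_mem_source_transition hu hu'] with v hv
  simp [e.left_inv hv]

variable [ChartedSpace Plane S]

theorem IsC2Immersion.inversion_comp (hf : IsC2Immersion f) (hf0 : ∀ p, f p ≠ 0) :
    IsC2Immersion (inversion ∘ f) where
  contMDiff p := (contDiffAt_inversion (hf0 p)).contMDiffAt.comp p (hf.contMDiff p)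
  injective_mfderiv p := by
    have h1 : MDifferentiableAt (𝓡 2) 𝓘(ℝ, Ambient n) f p :=
      hf.contMDiff.mdifferentiableAt (by norm_num)
    have h2 : MDifferentiableAt 𝓘(ℝ, Ambient n) 𝓘(ℝ, Ambient n) inversion (f p) :=
      ((contDiffAt_inversion (hf0 p) (k := 1)).differentiableAt (by norm_num)).mdifferentiableAt
    rw [mfderiv_comp p h2 h1, mfderiv_eq_fderiv]
    exact (fderiv_inversion_injective (hf0 p)).comp (hf.injective_mfderiv p)

theorem continuous_of_chart {E : Type*} [TopologicalSpace E] {Q : S → E}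
    (q : OpenPartialHomeomorph S Plane → Plane → E)
    (hq : ∀ e ∈ atlas Plane S, ContinuousOn (q e) e.target)
    (hQ : ∀ e ∈ atlas Plane S, ∀ p ∈ e.source, Q p = q e (e p)) : Continuous Q := by
  rw [continuous_iff_continuousAt]
  intro p
  have he := chart_mem_atlas Plane p
  have hp := mem_chart_source Plane p
  have h1 := (hq _ he).continuousAt ((chartAt Plane p).open_target.mem_nhds
    ((chartAt Plane p).map_source hp))
  refine (h1.comp ((chartAt Plane p).continuousAt hp)).congr ?_
  filter_upwards [(chartAt Plane p).open_source.mem_nhds hp] with x hx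
  exact (hQ _ he x hx).symm

/-- The pairing of `dρ` with `⟨f, df⟩ / |f|²` with respect to the induced metric. -/
def logPairing (f : S → Ambient n) (ρ : S → ℝ) (p : S) : ℝ :=
  localLogPairing (f ∘ (chartAt Plane p).symm) (ρ ∘ (chartAt Plane p).symm) (chartAt Plane p p)

theorem logPairing_eq_zero {ρ : S → ℝ} {p : S} (h : ρ =ᶠ[nhds p] fun _ => 0) :
    logPairing f ρ p = 0 := by
  have hp := mem_chart_source Plane p
  have h1 : ρ ∘ (chartAt Plane p).symm =ᶠ[nhds (chartAt Plane p p)] fun _ => 0 := by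
    have hc := (chartAt Plane p).continuousAt_symm ((chartAt Plane p).map_source hp)
    rw [ContinuousAt, (chartAt Plane p).left_inv hp] at hc
    exact hc.eventually h
  simp [logPairing, localLogPairing, h1.fderiv_eq]

/-! ### Regularity of transition maps and chart independence. -/

variable [IsManifold (𝓡 2) 2 S]

theorem contMDiffOn_chart_symm (he : e ∈ atlas Plane S) :
    ContMDiffOn (𝓡 2) (𝓡 2) 2 e.symm e.target :=
  contMDiffOn_symm_of_mem_maximalAtlas (IsManifold.subset_maximalAtlas he)

theorem contMDiffOn_atlas_chart (he : e ∈ atlas Plane S) :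
    ContMDiffOn (𝓡 2) (𝓡 2) 2 e e.source :=
  contMDiffOn_of_mem_maximalAtlas (IsManifold.subset_maximalAtlas he)

theorem contDiffOn_comp_chart_symm {E : Type*} [NormedAddCommGroup E] [NormedSpace ℝ E]
    {g : S → E} (hg : ContMDiff (𝓡 2) 𝓘(ℝ, E) 2 g) (he : e ∈ atlas Plane S) :
    ContDiffOn ℝ 2 (g ∘ e.symm) e.target :=
  (hg.comp_contMDiffOn (contMDiffOn_chart_symm he)).contDiffOn

theorem contDiffAt_transition (he : e ∈ atlas Plane S) (he' : e' ∈ atlas Plane S) {u : Plane}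
    (hu : u ∈ e'.target) (hu' : e'.symm u ∈ e.source) : ContDiffAt ℝ 2 (e ∘ e'.symm) u := by
  have h1 := (contMDiffOn_atlas_chart he).contMDiffAt (e.open_source.mem_nhds hu')
  have h2 := (contMDiffOn_chart_symm he').contMDiffAt (e'.open_target.mem_nhds hu)
  exact (h1.comp u h2).contDiffAt

theorem injective_fderiv_transition (he : e ∈ atlas Plane S) (he' : e' ∈ atlas Plane S)
    {u : Plane} (hu : u ∈ e'.target) (hu' : e'.symm u ∈ e.source) :
    Function.Injective (fderiv ℝ (e ∘ e'.symm) u) := by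
  have h1 := (contDiffAt_transition he he' hu hu').differentiableAt (by norm_num)
  have h2 : ContDiffAt ℝ 2 (e' ∘ e.symm) ((e ∘ e'.symm) u) :=
    contDiffAt_transition he' he (e.map_source hu') (by
      simpa [e.left_inv hu'] using e'.map_target hu)
  have h3 : (e' ∘ e.symm) ∘ (e ∘ e'.symm) =ᶠ[nhds u] id := by
    filter_upwards [eventually_mem_source_transition hu hu', e'.open_target.mem_nhds hu]
      with v hv hv'
    simp [e.left_inv hv, e'.right_inv hv']
  have h4 := fderiv_comp u (h2.differentiableAt (by norm_num)) h1
  rw [h3.fderiv_eq, fderiv_id] at h4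
  intro x y hxy
  have h5 := congrArg (fderiv ℝ (e' ∘ e.symm) ((e ∘ e'.symm) u)) hxy
  rw [← ContinuousLinearMap.comp_apply, ← ContinuousLinearMap.comp_apply, ← h4] at h5
  exact h5

theorem IsC2Immersion.isLocalImmersion (hf : IsC2Immersion f) (he : e ∈ atlas Plane S) :
    IsLocalImmersion (f ∘ e.symm) e.target where
  isOpen := e.open_target
  contDiffOn := contDiffOn_comp_chart_symm hf.contMDiff he
  injective u hu := by
    have h1 : MDifferentiableAt (𝓡 2) 𝓘(ℝ, Ambient n) f (e.symm u) :=
      hf.contMDiff.mdifferentiableAt (by norm_num)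
    have h2 : MDifferentiableAt (𝓡 2) (𝓡 2) e.symm u :=
      ((contMDiffOn_chart_symm he).contMDiffAt (e.open_target.mem_nhds hu)).mdifferentiableAt
        (by norm_num)
    have h3 : MDifferentiableAt (𝓡 2) (𝓡 2) e (e.symm u) :=
      ((contMDiffOn_atlas_chart he).contMDiffAt
        (e.open_source.mem_nhds (e.map_target hu))).mdifferentiableAt (by norm_num)
    have h4 : (e ∘ e.symm : Plane → Plane) =ᶠ[nhds u] id := by
      filter_upwards [e.open_target.mem_nhds hu] with v hv
      exact e.right_inv hv
    have h5 := mfderiv_comp u h3 h2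
    rw [h4.mfderiv_eq, mfderiv_id] at h5
    have h6 : Function.Injective (mfderiv (𝓡 2) (𝓡 2) e.symm u) := by
      intro x y hxy
      have h7 := congrArg (mfderiv (𝓡 2) (𝓡 2) e (e.symm u)) hxy
      rw [← ContinuousLinearMap.comp_apply, ← ContinuousLinearMap.comp_apply, ← h5] at h7
      exact h7
    rw [← mfderiv_eq_fderiv, mfderiv_comp u h1 h2]
    exact (hf.injective_mfderiv _).comp h6

theorem IsC2Immersion.localMeanCurvature_chart (hf : IsC2Immersion f) (he : e ∈ atlas Plane S)
    (he' : e' ∈ atlas Plane S) {p : S} (hp : p ∈ e.source) (hp' : p ∈ e'.source) :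
    localMeanCurvature (f ∘ e'.symm) (e' p) = localMeanCurvature (f ∘ e.symm) (e p) := by
  have hu := e'.map_source hp'
  have hu' : e'.symm (e' p) ∈ e.source := by rwa [e'.left_inv hp']
  rw [localMeanCurvature_congr (comp_transition_eventuallyEq f hu hu'), localMeanCurvature_comp
    ((hf.isLocalImmersion he).contDiffAt (e.map_source hu'))
    (contDiffAt_transition he he' hu hu') (injective_fderiv_transition he he' hu hu')]
  simp [e'.left_inv hp']

theorem IsC2Immersion.meanCurvature_eq (hf : IsC2Immersion f) (he : e ∈ atlas Plane S)
    {p : S} (hp : p ∈ e.source) :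
    meanCurvature f p = localMeanCurvature (f ∘ e.symm) (e p) :=
  hf.localMeanCurvature_chart he (chart_mem_atlas _ p) hp (mem_chart_source _ p)

theorem IsC2Immersion.continuous_meanCurvature (hf : IsC2Immersion f) :
    Continuous (meanCurvature f) :=
  continuous_of_chart (fun e => localMeanCurvature (f ∘ e.symm))
    (fun _ he => (hf.isLocalImmersion he).continuousOn_localMeanCurvature)
    fun _ he _ hp => hf.meanCurvature_eq he hp

theorem IsC2Immersion.continuous_norm_meanCurvature_sq (hf : IsC2Immersion f) :
    Continuous fun p => ‖meanCurvature f p‖ ^ 2 :=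
  hf.continuous_meanCurvature.norm.pow 2

theorem IsC2Immersion.logPairing_eq (hf : IsC2Immersion f) {ρ : S → ℝ}
    (hρ : ContMDiff (𝓡 2) 𝓘(ℝ, ℝ) 2 ρ) (he : e ∈ atlas Plane S) {p : S} (hp : p ∈ e.source) :
    logPairing f ρ p = localLogPairing (f ∘ e.symm) (ρ ∘ e.symm) (e p) := by
  set e' := chartAt Plane p
  have he' : e' ∈ atlas Plane S := chart_mem_atlas _ p
  have hp' : p ∈ e'.source := mem_chart_source _ p
  have hu := e'.map_source hp'
  have hu' : e'.symm (e' p) ∈ e.source := by rwa [e'.left_inv hp']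
  have hr : DifferentiableAt ℝ (ρ ∘ e.symm) ((e ∘ e'.symm) (e' p)) :=
    ((contDiffOn_comp_chart_symm hρ he).contDiffAt (e.open_target.mem_nhds
      (e.map_source hu'))).differentiableAt (by norm_num)
  rw [logPairing, localLogPairing_congr (comp_transition_eventuallyEq f hu hu')
    (comp_transition_eventuallyEq ρ hu hu'), localLogPairing_comp
    (((hf.isLocalImmersion he).contDiffAt (e.map_source hu')).differentiableAt (by norm_num))
    ((contDiffAt_transition he he' hu hu').differentiableAt (by norm_num)) hr
    (injective_fderiv_transition he he' hu hu')]
  simp [e'.left_inv hp']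

theorem IsC2Immersion.continuous_logPairing (hf : IsC2Immersion f) (hf0 : ∀ p, f p ≠ 0) {ρ : S → ℝ}
    (hρ : ContMDiff (𝓡 2) 𝓘(ℝ, ℝ) 2 ρ) : Continuous (logPairing f ρ) :=
  continuous_of_chart (fun e => localLogPairing (f ∘ e.symm) (ρ ∘ e.symm))
    (fun _ he => (hf.isLocalImmersion he).continuousOn_localLogPairing (fun _ _ => hf0 _)
      ((contDiffOn_comp_chart_symm hρ he).of_le (by norm_num)))
    fun _ he _ hp => hf.logPairing_eq hρ he hp

/-- The pairing is linear in `dρ`, and the differentials of functions with constant sum add up to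
zero. -/
theorem sum_logPairing_eq_zero {ι : Type*} {t : Finset ι} {ρ : ι → S → ℝ}
    (hρ : ∀ k ∈ t, ContMDiff (𝓡 2) 𝓘(ℝ, ℝ) 2 (ρ k)) (h1 : ∀ p, ∑ k ∈ t, ρ k p = 1) (p : S) :
    ∑ k ∈ t, logPairing f (ρ k) p = 0 := by
  have he := chart_mem_atlas Plane p
  have hu := (chartAt Plane p).map_source (mem_chart_source Plane p)
  have hd : ∑ k ∈ t, fderiv ℝ (ρ k ∘ (chartAt Plane p).symm) (chartAt Plane p p) = 0 := by
    rw [← fderiv_fun_sum]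
    · have : (fun u => ∑ k ∈ t, (ρ k ∘ (chartAt Plane p).symm) u) = fun _ => 1 := by
        funext u
        exact h1 _
      rw [this]
      simp
    · intro k hk
      exact ((contDiffOn_comp_chart_symm (hρ k hk) he).contDiffAt
        ((chartAt Plane p).open_target.mem_nhds hu)).differentiableAt (by norm_num)
  have hd' (i : Fin 2) := congrArg (fun T : Plane →L[ℝ] ℝ => T (stdVec i)) hd
  simp only [sum_apply, zero_apply] at hd'
  simp only [logPairing, localLogPairing]
  rw [Finset.sum_comm]
  refine Finset.sum_eq_zero fun i _ => ?_
  rw [Finset.sum_comm]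
  refine Finset.sum_eq_zero fun j _ => ?_
  rw [← Finset.mul_sum, ← Finset.sum_mul, hd', zero_mul, mul_zero]

end Charts

/-! ### The area measure in charts -/

section AreaMeasure

variable {n : ℕ} {S : Type*} [TopologicalSpace S] [MeasurableSpace S] [BorelSpace S]
  {f : S → Ambient n} {e e' : OpenPartialHomeomorph S Plane}

theorem _root_.ContinuousOn.measurableSet_inter_preimage_of_measurableSet {X Y : Type*}
    [TopologicalSpace X] [MeasurableSpace X] [BorelSpace X] [TopologicalSpace Y]
    [MeasurableSpace Y] [BorelSpace Y] {g : X → Y} {t : Set X} (hg : ContinuousOn g t)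
    (ht : MeasurableSet t) {s : Set Y} (hs : MeasurableSet s) : MeasurableSet (t ∩ g ⁻¹' s) := by
  have := ht.subtype_image ((continuousOn_iff_continuous_domRestrict.1 hg).measurable hs)
  convert this using 1
  ext x
  simp [and_comm]

theorem aemeasurable_chart_symm (ν : Measure Plane) :
    AEMeasurable e.symm (ν.restrict e.target) :=
  ContinuousOn.aemeasurable e.continuousOn_symm e.open_target.measurableSet

theorem chartAreaMeasure_apply (f : S → Ambient n) (e : OpenPartialHomeomorph S Plane)
    {s : Set S} (hs : MeasurableSet s) :
    chartAreaMeasure f e s = ∫⁻ u in e.target ∩ e.symm ⁻¹' s,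
      ENNReal.ofReal (areaDensity (f ∘ e.symm) u) := by
  have hm := ContinuousOn.measurableSet_inter_preimage_of_measurableSet e.continuousOn_symm
    e.open_target.measurableSet hs
  rw [chartAreaMeasure, Measure.map_apply_of_aemeasurable
    ((aemeasurable_chart_symm volume).mono_ac (withDensity_absolutelyContinuous _ _)) hs,
    withDensity_apply', Measure.restrict_restrict' e.open_target.measurableSet, Set.inter_comm]

theorem chartAreaMeasure_inter_source (f : S → Ambient n) (e : OpenPartialHomeomorph S Plane)
    {s : Set S} (hs : MeasurableSet s) :
    chartAreaMeasure f e (s ∩ e.source) = chartAreaMeasure f e s := by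
  rw [chartAreaMeasure_apply f e hs,
    chartAreaMeasure_apply f e (hs.inter e.open_source.measurableSet)]
  congr 2
  ext u
  simp only [Set.mem_inter_iff, Set.mem_preimage]
  exact ⟨fun h => ⟨h.1, h.2.1⟩, fun h => ⟨h.1, h.2, e.map_target h.1⟩⟩

variable [ChartedSpace Plane S] [IsManifold (𝓡 2) 2 S]

/-- Change of variables along the transition map: its Jacobian determinant is exactly the factor by
which the area densities differ (`areaDensity_comp`). -/
theorem IsC2Immersion.chartAreaMeasure_eq (hf : IsC2Immersion f) (he : e ∈ atlas Plane S)
    (he' : e' ∈ atlas Plane S) {s : Set S} (hs : MeasurableSet s) (h : s ⊆ e.source)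
    (h' : s ⊆ e'.source) : chartAreaMeasure f e s = chartAreaMeasure f e' s := by
  have hm := ContinuousOn.measurableSet_inter_preimage_of_measurableSet e'.continuousOn_symm
    e'.open_target.measurableSet hs
  have himage : (e ∘ e'.symm) '' (e'.target ∩ e'.symm ⁻¹' s) = e.target ∩ e.symm ⁻¹' s := by
    ext v
    constructor
    · rintro ⟨u, ⟨hu, hus⟩, rfl⟩
      refine ⟨e.map_source (h hus), ?_⟩
      simpa [e.left_inv (h hus)] using hus
    · rintro ⟨hv, hvs⟩
      refine ⟨e' (e.symm v), ⟨e'.map_source (h' hvs), ?_⟩, ?_⟩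
      · simpa [e'.left_inv (h' hvs)] using hvs
      · simp [e'.left_inv (h' hvs), e.right_inv hv]
  have hinj : Set.InjOn (e ∘ e'.symm) (e'.target ∩ e'.symm ⁻¹' s) := by
    rintro u ⟨hu, hus⟩ v ⟨hv, hvs⟩ huv
    exact e'.symm.injOn hu hv (e.injOn (h hus) (h hvs) huv)
  rw [chartAreaMeasure_apply f e hs, chartAreaMeasure_apply f e' hs, ← himage,
    lintegral_image_eq_lintegral_abs_det_fderiv_mul volume hm
      (fun u hu => (((contDiffAt_transition he he' hu.1 (h hu.2)).differentiableAt
        (by norm_num)).hasFDerivAt).hasFDerivWithinAt) hinj]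
  refine setLIntegral_congr_fun hm fun u hu => ?_
  have hd := (contDiffAt_transition he he' hu.1 (h hu.2)).differentiableAt (by norm_num)
  have hd' : DifferentiableAt ℝ (f ∘ e.symm) ((e ∘ e'.symm) u) :=
    ((hf.isLocalImmersion he).contDiffAt (e.map_source (h hu.2))).differentiableAt (by norm_num)
  have hc : areaDensity (f ∘ e'.symm) u = areaDensity ((f ∘ e.symm) ∘ (e ∘ e'.symm)) u := by
    rw [areaDensity, areaDensity,
      metricMatrix_congr (comp_transition_eventuallyEq f hu.1 (h hu.2))]
  simp only [hc]
  rw [areaDensity_comp hd' hd, ENNReal.ofReal_mul (abs_nonneg _)]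

/-- The area measure agrees with the area measure of a chart on its domain. -/
theorem IsC2Immersion.restrict_areaMeasure (hf : IsC2Immersion f) (he : e ∈ atlas Plane S) :
    (areaMeasure f).restrict e.source = chartAreaMeasure f e := by
  -- A measure that is infinite on every nonempty measurable set meeting the complement of
  -- `e.source` dominates all chart measures there trivially. The sum is thus an upper bound for the
  -- supremum, and on `e.source` it reduces to the chart measure of `e`.
  have hle : areaMeasure f ≤ chartAreaMeasure f e +
      ((⊤ : ENNReal) • Measure.count).restrict e.sourceᶜ := by
    refine iSup₂_le fun e' he' => Measure.le_iff.2 fun s hs => ?_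
    rw [Measure.add_apply, Measure.restrict_apply hs]
    by_cases hne : (s ∩ e.sourceᶜ).Nonempty
    · rw [Measure.smul_apply, smul_eq_mul, ENNReal.top_mul (Measure.count_ne_zero hne), add_top]
      exact le_top
    · have hse : s ⊆ e.source := by
        rwa [Set.not_nonempty_iff_eq_empty, ← Set.sdiff_eq, Set.sdiff_eq_empty] at hne
      rw [← chartAreaMeasure_inter_source f e' hs, ← hf.chartAreaMeasure_eq he he'
        (hs.inter e'.open_source.measurableSet) (Set.inter_subset_left.trans hse)
        Set.inter_subset_right]
      exact (measure_mono Set.inter_subset_left).trans le_self_add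
  have hge : chartAreaMeasure f e ≤ areaMeasure f := le_iSup₂_of_le e he le_rfl
  ext s hs
  rw [Measure.restrict_apply hs, ← chartAreaMeasure_inter_source f e hs]
  refine le_antisymm ((hle _).trans ?_) (hge _)
  rw [Measure.add_apply, Measure.restrict_apply (hs.inter e.open_source.measurableSet),
    Set.inter_assoc, Set.inter_compl_self, Set.inter_empty, measure_empty, add_zero]

theorem IsC2Immersion.integral_areaMeasure (hf : IsC2Immersion f) (he : e ∈ atlas Plane S)
    {h : S → ℝ} (hh : Continuous h) (h0 : ∀ p ∉ e.source, h p = 0) :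
    ∫ p, h p ∂areaMeasure f =
      ∫ u in e.target, areaDensity (f ∘ e.symm) u * h (e.symm u) := by
  have hd : AEMeasurable (fun u => ENNReal.ofReal (areaDensity (f ∘ e.symm) u))
      (volume.restrict e.target) :=
    (((hf.isLocalImmersion he).contDiffOn_areaDensity.continuousOn).aemeasurable
      e.open_target.measurableSet).ennreal_ofReal
  rw [← setIntegral_eq_integral_of_forall_compl_eq_zero h0, hf.restrict_areaMeasure he,
    chartAreaMeasure, integral_map ((aemeasurable_chart_symm volume).mono_ac
      (withDensity_absolutelyContinuous _ _)) hh.aestronglyMeasurable,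
    integral_withDensity_eq_integral_toReal_smul₀ hd (by simp)]
  refine integral_congr_ae (Filter.Eventually.of_forall fun u => ?_)
  simp only [smul_eq_mul]
  rw [ENNReal.toReal_ofReal (show 0 ≤ areaDensity (f ∘ e.symm) u from Real.sqrt_nonneg _)]

theorem IsC2Immersion.isLocallyFiniteMeasure (hf : IsC2Immersion f) :
    IsLocallyFiniteMeasure (areaMeasure f) := by
  refine ⟨fun p => ?_⟩
  set e := chartAt Plane p
  have he : e ∈ atlas Plane S := chart_mem_atlas _ p
  have hp : p ∈ e.source := mem_chart_source _ p
  obtain ⟨r, hr, hb⟩ := Metric.nhds_basis_closedBall.mem_iff.1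
    (e.open_target.mem_nhds (e.map_source hp))
  have ho : IsOpen (e.source ∩ e ⁻¹' Metric.ball (e p) r) :=
    e.isOpen_inter_preimage Metric.isOpen_ball
  refine ⟨_, ho.mem_nhds ⟨hp, Metric.mem_ball_self hr⟩, ?_⟩
  have h1 : areaMeasure f (e.source ∩ e ⁻¹' Metric.ball (e p) r) =
      chartAreaMeasure f e (e.source ∩ e ⁻¹' Metric.ball (e p) r) := by
    rw [← hf.restrict_areaMeasure he, Measure.restrict_apply ho.measurableSet,
      Set.inter_eq_left.2 Set.inter_subset_left]
  rw [h1, chartAreaMeasure_apply f e ho.measurableSet]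
  have h2 : IntegrableOn (areaDensity (f ∘ e.symm)) (Metric.closedBall (e p) r) :=
    ((hf.isLocalImmersion he).contDiffOn_areaDensity.continuousOn.mono hb).integrableOn_compact
      (isCompact_closedBall _ _)
  refine (lintegral_mono_set ?_).trans_lt h2.lintegral_lt_top
  rintro u ⟨hu, -, hu'⟩
  rw [Set.mem_preimage, e.right_inv hu] at hu'
  exact Metric.ball_subset_closedBall hu'

theorem IsC2Immersion.integrable_of_continuous [CompactSpace S] (hf : IsC2Immersion f) {h : S → ℝ}
    (hh : Continuous h) : Integrable h (areaMeasure f) :=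
  haveI := hf.isLocallyFiniteMeasure
  hh.integrable_of_hasCompactSupport (HasCompactSupport.of_compactSpace h)

theorem IsC2Immersion.integral_eq_sum [CompactSpace S] (hf : IsC2Immersion f) {h : S → ℝ}
    (hh : Continuous h) {t : Finset S} {ρ : S → S → ℝ} (hρ : ∀ k, Continuous (ρ k))
    (h1 : ∀ p, ∑ k ∈ t, ρ k p = 1) :
    ∫ p, h p ∂areaMeasure f = ∑ k ∈ t, ∫ p, ρ k p * h p ∂areaMeasure f := by
  have hi : ∀ k ∈ t, Integrable (fun p => ρ k p * h p) (areaMeasure f) := fun k _ =>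
    hf.integrable_of_continuous ((hρ k).mul hh)
  rw [← integral_finsetSum _ hi]
  simp [← Finset.sum_mul, h1]

end AreaMeasure

/-! ### Partitions of unity and the invariance of the Willmore energy -/

section Global

variable {n : ℕ} {S : Type*} [TopologicalSpace S] [T2Space S] [ChartedSpace Plane S]
  [IsManifold (𝓡 2) 2 S] {f : S → Ambient n} {e : OpenPartialHomeomorph S Plane}

/-- `ρ` vanishes outside a compact subset of the domain of `e`. -/
def IsCompactlySupportedIn (e : OpenPartialHomeomorph S Plane) (ρ : S → ℝ) : Prop :=
  ∃ K ⊆ e.source, IsCompact K ∧ ∀ p ∉ K, ρ p = 0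

theorem exists_bump (p : S) : ∃ b : S → ℝ, ContMDiff (𝓡 2) 𝓘(ℝ, ℝ) 2 b ∧ (∀ x, 0 ≤ b x) ∧
    0 < b p ∧ IsCompactlySupportedIn (chartAt Plane p) b := by
  set e := chartAt Plane p with he_def
  have he : e ∈ atlas Plane S := chart_mem_atlas _ p
  have hp : p ∈ e.source := mem_chart_source _ p
  obtain ⟨r, hr, hb⟩ := Metric.nhds_basis_closedBall.mem_iff.1
    (e.open_target.mem_nhds (e.map_source hp))
  let β : ContDiffBump (e p) := ⟨r / 2, r, by positivity, by linarith⟩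
  have hK : IsCompact (e.symm '' Metric.closedBall (e p) r) :=
    (isCompact_closedBall _ _).image_of_continuousOn (e.continuousOn_symm.mono hb)
  have h0 : ∀ x ∉ e.symm '' Metric.closedBall (e p) r,
      e.source.indicator (fun x => β (e x)) x = 0 := by
    intro x hx
    by_cases hxe : x ∈ e.source
    · rw [Set.indicator_of_mem hxe]
      refine β.zero_of_le_dist (le_of_not_ge fun h => hx ⟨e x, h, e.left_inv hxe⟩)
    · exact Set.indicator_of_notMem hxe _
  have hKs : e.symm '' Metric.closedBall (e p) r ⊆ e.source := by
    rintro _ ⟨u, hu, rfl⟩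
    exact e.map_target (hb hu)
  refine ⟨e.source.indicator fun x => β (e x), ?_, ?_, ?_, _, hKs, hK, h0⟩
  · intro x
    by_cases hx : x ∈ e.source
    · have h1 := (contMDiffOn_atlas_chart he).contMDiffAt (e.open_source.mem_nhds hx)
      have h2 : ContMDiffAt (𝓡 2) 𝓘(ℝ, ℝ) 2 (fun u => β u) (e x) :=
        (β.contDiff (n := 2)).contDiffAt.contMDiffAt
      refine (h2.comp x h1).congr_of_eventuallyEq ?_
      filter_upwards [e.open_source.mem_nhds hx] with y hy
      exact Set.indicator_of_mem hy _
    · refine (contMDiffAt_const (c := (0 : ℝ))).congr_of_eventuallyEq ?_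
      -- The Hausdorff property makes the compact support closed in the surface, so the extension by
      -- zero vanishes near every point outside the chart.
      filter_upwards [hK.isClosed.isOpen_compl.mem_nhds fun h => hx (hKs h)] with y hy
      exact h0 y hy
  · intro x
    exact Set.indicator_nonneg (fun _ _ => β.nonneg) x
  · rw [Set.indicator_of_mem hp]
    exact β.pos_of_mem_ball (Metric.mem_ball_self hr)

/-- By compactness finitely many bumps have positive sum everywhere; each is divided by that sum.
The supports do not grow. -/
theorem exists_partitionOfUnity [CompactSpace S] : ∃ (t : Finset S) (ρ : S → S → ℝ),
    (∀ k, ContMDiff (𝓡 2) 𝓘(ℝ, ℝ) 2 (ρ k)) ∧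
      (∀ k, IsCompactlySupportedIn (chartAt Plane k) (ρ k)) ∧ ∀ p, ∑ k ∈ t, ρ k p = 1 := by
  choose b hb hb0 hbp hbs using exists_bump (S := S)
  obtain ⟨t, ht⟩ := isCompact_univ.elim_finite_subcover (fun k : S => {x | 0 < b k x})
    (fun k => isOpen_lt continuous_const (hb k).continuous)
    fun x _ => Set.mem_iUnion.2 ⟨x, hbp x⟩
  have hpos (x : S) : 0 < ∑ k ∈ t, b k x := by
    obtain ⟨k, hk, hx⟩ := Set.mem_iUnion₂.1 (ht (Set.mem_univ x))
    exact Finset.sum_pos' (fun j _ => hb0 j x) ⟨k, hk, hx⟩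
  have hsum : ContMDiff (𝓡 2) 𝓘(ℝ, ℝ) 2 fun x => ∑ k ∈ t, b k x :=
    contMDiff_finsetSum fun k _ => hb k
  refine ⟨t, fun k x => b k x / ∑ j ∈ t, b j x, fun k => (hb k).div₀ hsum fun x => (hpos x).ne',
    fun k => ?_, fun p => ?_⟩
  · obtain ⟨K, hK, hKc, h0⟩ := hbs k
    exact ⟨K, hK, hKc, fun p hp => by simp [h0 p hp]⟩
  · rw [← Finset.sum_div, div_self (hpos p).ne']

variable [MeasurableSpace S] [BorelSpace S]

/-- All three integrands vanish outside the domain of `e`, so the integrals can be pulled back to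
the parameter plane, where `setIntegral_inversion_comp` applies. -/
theorem IsC2Immersion.integral_mul_inversion_comp (hf : IsC2Immersion f) (hf0 : ∀ p, f p ≠ 0)
    (he : e ∈ atlas Plane S) {ρ : S → ℝ} (hρ : ContMDiff (𝓡 2) 𝓘(ℝ, ℝ) 2 ρ)
    (hs : IsCompactlySupportedIn e ρ) :
    ∫ p, ρ p * ‖meanCurvature (inversion ∘ f) p‖ ^ 2 ∂areaMeasure (inversion ∘ f) =
      (∫ p, ρ p * ‖meanCurvature f p‖ ^ 2 ∂areaMeasure f) -
        8 * ∫ p, logPairing f ρ p ∂areaMeasure f := by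
  obtain ⟨K, hKe, hK, h0⟩ := hs
  have hg := hf.inversion_comp hf0
  have hK' : IsCompact (e '' K) := hK.image_of_continuousOn (e.continuousOn.mono hKe)
  have hKt : e '' K ⊆ e.target := by
    rintro _ ⟨p, hp, rfl⟩
    exact e.map_source (hKe hp)
  have hr0 : ∀ u ∈ e.target, u ∉ e '' K → (ρ ∘ e.symm) u = 0 := fun u hu hu' =>
    h0 _ fun h => hu' ⟨_, h, e.right_inv hu⟩
  have hz : ∀ p ∉ e.source, ρ p = 0 := fun p hp => h0 p fun h => hp (hKe h)
  have hl : ∀ p ∉ e.source, logPairing f ρ p = 0 := fun p hp => by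
    refine logPairing_eq_zero ?_
    filter_upwards [hK.isClosed.isOpen_compl.mem_nhds fun h => hp (hKe h)] with x hx
    exact h0 x hx
  have hloc := (hf.isLocalImmersion he).setIntegral_inversion_comp (fun _ _ => hf0 _) hK' hKt
    ((contDiffOn_comp_chart_symm hρ he).of_le (by norm_num)) hr0
  have hcg : Continuous fun p => ρ p * ‖meanCurvature (inversion ∘ f) p‖ ^ 2 :=
    hρ.continuous.mul hg.continuous_norm_meanCurvature_sq
  have hcf : Continuous fun p => ρ p * ‖meanCurvature f p‖ ^ 2 :=
    hρ.continuous.mul hf.continuous_norm_meanCurvature_sq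
  rw [hg.integral_areaMeasure he hcg fun p hp => by simp [hz p hp],
    hf.integral_areaMeasure he hcf fun p hp => by simp [hz p hp],
    hf.integral_areaMeasure he (hf.continuous_logPairing hf0 hρ) hl]
  have hm := e.open_target.measurableSet
  refine Eq.trans (setIntegral_congr_fun hm fun u hu => ?_) (hloc.trans (congrArg₂ _
    (setIntegral_congr_fun hm fun u hu => ?_) (congrArg _
      (setIntegral_congr_fun hm fun u hu => ?_))))
  · simp only [hg.meanCurvature_eq he (e.map_target hu), e.right_inv hu, Function.comp_apply,
      Function.comp_assoc]
  · simp only [hf.meanCurvature_eq he (e.map_target hu), e.right_inv hu, Function.comp_apply]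
  · simp only [hf.logPairing_eq hρ he (e.map_target hu), e.right_inv hu]

theorem IsC2Immersion.energy_inversion_comp [CompactSpace S] (hf : IsC2Immersion f)
    (hf0 : ∀ p, f p ≠ 0) : energy f = energy (inversion ∘ f) := by
  obtain ⟨t, ρ, hρ, hs, h1⟩ := exists_partitionOfUnity (S := S)
  have hg := hf.inversion_comp hf0
  -- All corrections are integrated against the same measure `areaMeasure f`, so their sum may be
  -- taken under the integral, where it vanishes pointwise.
  have hz : ∑ k ∈ t, ∫ p, logPairing f (ρ k) p ∂areaMeasure f = 0 := by
    rw [← integral_finsetSum _ fun k _ =>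
      hf.integrable_of_continuous (hf.continuous_logPairing hf0 (hρ k))]
    simp [sum_logPairing_eq_zero (fun k _ => hρ k) h1]
  rw [energy, energy,
    hf.integral_eq_sum hf.continuous_norm_meanCurvature_sq (fun k => (hρ k).continuous) h1,
    hg.integral_eq_sum hg.continuous_norm_meanCurvature_sq (fun k => (hρ k).continuous) h1]
  simp only [hf.integral_mul_inversion_comp hf0 (chart_mem_atlas _ _) (hρ _) (hs _),
    Finset.sum_sub_distrib, ← Finset.mul_sum, hz, mul_zero, sub_zero]

end Global

end Willmore

end

theorem mainTheorem5 {n : ℕ} {S : Type*} [TopologicalSpace S] [T2Space S] [CompactSpace S]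
    [ChartedSpace Willmore.Plane S] [IsManifold (𝓡 2) 2 S] [MeasurableSpace S] [BorelSpace S]
    (f : S → Willmore.Ambient n) (hf : Willmore.IsC2Immersion f) (hf0 : ∀ p, f p ≠ 0) :
    Willmore.IsC2Immersion (Willmore.inversion ∘ f) ∧
      Integrable (fun p => ‖Willmore.meanCurvature f p‖ ^ 2) (Willmore.areaMeasure f) ∧
      Integrable (fun p => ‖Willmore.meanCurvature (Willmore.inversion ∘ f) p‖ ^ 2)
        (Willmore.areaMeasure (Willmore.inversion ∘ f)) ∧
      Willmore.energy f = Willmore.energy (Willmore.inversion ∘ f) :=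
  have hg := hf.inversion_comp hf0
  ⟨hg, hf.integrable_of_continuous hf.continuous_norm_meanCurvature_sq,
    hg.integrable_of_continuous hg.continuous_norm_meanCurvature_sq,
    hf.energy_inversion_comp hf0⟩
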